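/- Let $G$ be a (discrete) group, $L\ge 1$, and $T\in\mathrm{Aut}(G)$ with $T^L=\mathrm{id}$. For each site $j\in\mathbb{Z}/L$ let $g\mapsto U_{g,j}$ be a (linear) unitary representation of $G$ on $\mathbb{C}^d$, and put $\mathcal{U}_g=\bigotimes_{j\in\mathbb Z/L}U_{g,j}$ on the periodic chain of $L$ sites. Assume that the one-site translation $\mathcal{T}$ (which moves an operator from site $j+1$ to site $j$) acts on the symmetry by the automorphism $T$: $\mathcal{T}\,\mathcal{U}_g\,\mathcal{T}^\dagger=\mathcal{U}_{T(g)}$ for all $g$. Let $A=(A^s)_{s=1}^d$ be $\chi\times\chi$ complex matrices. Assume that $A$ is left-canonical: $\sum_s A^{s\dagger}A^s=\mathbb 1$ and $\sum_s A^s\rho A^{s\dagger}=\rho$ for some positive definite $\rho$. Assume also that $A$ is injective: the transfer matrix $\mathbb{E}=\sum_s A^s\otimes (A^s)^*$ has a dominant eigenvalue whose eigenvector is unique up to scalars, and all other eigenvalues are strictly smaller in modulus. Assume that for every $g\in G$ and every $k\ge1$ the periodic matrix product state $\sum \mathrm{Tr}(A^{s_1}\cdots A^{s_{kL}})|s_1\cdots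 s_{kL}\rangle$ is mapped to a phase times itself by the $k$-fold periodic extension of $\mathcal{U}_g$. Extend $U_{g,j}$ periodically to $j\in\mathbb{Z}$. A *push-through family* consists of unitary $\chi\times\chi$ matrices $v_j(g)$ and phases $e^{i\phi_j(g)}$ ($j\in\mathbb{Z}$, $g\in G$) with $$\sum_{t}(U_{g,j})_{st}\,A^{t}=e^{i\phi_j(g)}\,v_{j-1}(g)^\dagger A^s\,v_j(g)\qquad\text{for all } s,j,g .$$ Call its phases *translation-covariant* if $e^{i\phi_{j+1}(g)}U_{T(g),j}=e^{i\phi_j(T(g))}U_{g,j+1}$ for all $j,g$; when the on-site phases are fixed so that $U_{g,j+1}=U_{T(g),j}$, this says $e^{i\phi_{j+1}(g)}=e^{i\phi_j(T(g))}$. Then: 1. There is a push-through family with translation-covariant phases and with $v_{j+L}=v_j$ for all $j$. 2. For every push-through family there are phases $e^{i\varphi_j(g)}$ with $v_{j+1}(g)=e^{i\varphi_j(g)}\,v_j(T(g))$ for all $j,g$. If its phases are translation-covariant, $\varphi_j=\varphi$ is independent of $j$: $v_{j+1}(g)=e^{i\varphi(g)}\,v_j(T(g))$. 3. For every push-through family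 the bond unitaries form projective representations: there are 2-cocycles $\omega_j\in Z^2(G,U(1))$ (trivial action of $G$ on $U(1)$) with $v_j(g)v_j(h)=\omega_j(g,h)\,v_j(gh)$. Their class $[\omega_j]=[\omega]\in H^2(G,U(1))$ does not depend on $j$, and $$[\omega(g,h)]=[\omega(T(g),T(h))]\quad\text{in } H^2(G,U(1)).$$ -/

import Mathlib

open scoped Matrix Kronecker ComplexOrder

noncomputable section

namespace ModulatedMPS

universe u

/-! ### Group cohomology with values in `U(1)` -/

/-- The coefficient module `U(1)` with trivial action of `G`
(lifted to the universe of `G`, as Mathlib's group cohomology asks). -/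
abbrev U1 (G : Type u) [Group G] : Rep.{u} (ULift.{u} ℤ) G :=
  Rep.trivial (ULift.{u} ℤ) G (Additive (ULift.{u} Circle))

/-- The group `Z²(G, U(1))` of 2-cocycles. -/
abbrev Cocycle (G : Type u) [Group G] : Type u := groupCohomology.cocycles₂ (U1 G)

/-- The value `ω(g, h) ∈ U(1)` of a 2-cocycle. -/
def Cocycle.val {G : Type u} [Group G] (ω : Cocycle G) (g h : G) : Circle :=
  (Additive.toMul (ω (g, h) : Additive (ULift.{u} Circle))).down

/-- The class `[ω] ∈ H²(G, U(1))`. -/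
def Cocycle.cls {G : Type u} [Group G] (ω : Cocycle G) : groupCohomology.H2 (U1 G) :=
  groupCohomology.H2π (U1 G) ω

/-- The pulled back cocycle `(g, h) ↦ ω(T g, T h)`. -/
def Cocycle.pullback {G : Type u} [Group G] (T : MulAut G) (ω : Cocycle G) : Cocycle G :=
  ⟨fun x => ω (T x.1, T x.2), by
    rw [groupCohomology.mem_cocycles₂_iff]
    intro g h j
    have := (groupCohomology.mem_cocycles₂_iff (A := U1 G) (ω : G × G → U1 G)).1 ω.2
      (T g) (T h) (T j)
    simpa using this⟩

/-! ### Matrix product states -/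

/-- The transfer matrix `𝔼 = ∑ₛ Aˢ ⊗ (Aˢ)*`. -/
def transferMatrix {d χ : ℕ} (A : Fin d → Matrix (Fin χ) (Fin χ) ℂ) :
    Matrix (Fin χ × Fin χ) (Fin χ × Fin χ) ℂ :=
  ∑ s, A s ⊗ₖ (A s).map (starRingEnd ℂ)

/-- Left-canonical form: the identity is a left fixed point of the transfer matrix and some
positive definite `ρ` is a right fixed point. -/
def IsLeftCanonical {d χ : ℕ} (A : Fin d → Matrix (Fin χ) (Fin χ) ℂ) : Prop :=
  ∑ s, (A s)ᴴ * A s = 1 ∧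
    ∃ ρ : Matrix (Fin χ) (Fin χ) ℂ, ρ.PosDef ∧ ∑ s, A s * ρ * (A s)ᴴ = ρ

/-- Injectivity: the transfer matrix has a dominant eigenvalue `μ₀` whose eigenvector is unique up
to scalars, and every other eigenvalue is strictly smaller in modulus (a spectral gap). -/
def IsInjective {d χ : ℕ} (A : Fin d → Matrix (Fin χ) (Fin χ) ℂ) : Prop :=
  ∃ μ₀ : ℂ,
    Module.finrank ℂ (Module.End.eigenspace (Matrix.toLin' (transferMatrix A)) μ₀) = 1 ∧
    ∀ μ : ℂ, Module.End.HasEigenvalue (Matrix.toLin' (transferMatrix A)) μ → μ ≠ μ₀ →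
      ‖μ‖ < ‖μ₀‖

/-- The state `∑ Tr(A^{s₁} ⋯ A^{sₙ}) |s₁ ⋯ sₙ⟩` on the periodic chain with `n` sites. -/
def mpsState {d χ : ℕ} (A : Fin d → Matrix (Fin χ) (Fin χ) ℂ) (n : ℕ) : (Fin n → Fin d) → ℂ :=
  fun s => Matrix.trace (List.ofFn fun j => A (s j)).prod

/-! ### Modulated symmetries -/

/-- The operator `⨂ⱼ U_{g,j}` on `n` consecutive sites, in the basis `|s₁ ⋯ sₙ⟩`; the on-site
unitaries repeat with period `L`. -/
def chainOp {G : Type u} [Group G] {L d : ℕ} (U : ZMod L → G →* Matrix.unitaryGroup (Fin d) ℂ)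
    (n : ℕ) (g : G) : Matrix (Fin n → Fin d) (Fin n → Fin d) ℂ :=
  Matrix.of fun s t => ∏ j : Fin n,
    (U ((j : ℕ) : ZMod L) g : Matrix (Fin d) (Fin d) ℂ) (s j) (t j)

/-- Translation by one site on the periodic chain with `n` sites, `|t⟩ ↦ |j ↦ t (j + 1)⟩`.
Conjugation by it moves an operator from site `j + 1` to site `j`. -/
def translation (d n : ℕ) : Matrix (Fin n → Fin d) (Fin n → Fin d) ℂ :=
  Matrix.of fun s t => if s = t ∘ finRotate n then 1 else 0

/-- The push-through condition `U_{g,j} · A = e^{i φ_j(g)} v_{j-1}(g)† A v_j(g)` on every site `j`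
of the infinite periodic extension of the chain: `v j g` lives on the bond between the
sites `j` and `j + 1`, and `p j g` is the phase `e^{i φ_j(g)}`. -/
def IsPushThrough {G : Type u} [Group G] {L d χ : ℕ}
    (U : ZMod L → G →* Matrix.unitaryGroup (Fin d) ℂ) (A : Fin d → Matrix (Fin χ) (Fin χ) ℂ)
    (v : ℤ → G → Matrix.unitaryGroup (Fin χ) ℂ) (p : ℤ → G → Circle) : Prop :=
  ∀ (j : ℤ) (g : G) (s : Fin d),
    ∑ t, (U (j : ZMod L) g : Matrix (Fin d) (Fin d) ℂ) s t • A t =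
      (p j g : ℂ) • ((v (j - 1) g : Matrix (Fin χ) (Fin χ) ℂ)ᴴ * A s *
        (v j g : Matrix (Fin χ) (Fin χ) ℂ))

/-- The push-through phases are normalized compatibly with translation. When the on-site phases
are fixed so that `U_{g,j+1} = U_{T g,j}`, this says `p_{j+1}(g) = p_j(T g)`. -/
def IsCovariantPhase {G : Type u} [Group G] {L d : ℕ} (T : MulAut G)
    (U : ZMod L → G →* Matrix.unitaryGroup (Fin d) ℂ) (p : ℤ → G → Circle) : Prop :=
  ∀ (j : ℤ) (g : G),
    (p (j + 1) g : ℂ) • (U (j : ZMod L) (T g) : Matrix (Fin d) (Fin d) ℂ) =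
      (p j (T g) : ℂ) • (U ((j : ZMod L) + 1) g : Matrix (Fin d) (Fin d) ℂ)

end ModulatedMPS

end

/-! Write `‖W‖² = Tr (W ρ W†)`. For an isometric tensor `B`, the map taking `W` to the `Y` with `∑ₛ
Bˢ W ρ Aˢ† = Y ρ` is a contraction, and the loss is explicit: `∑ₛ ‖Bˢ W - Y Aˢ‖² = ‖W‖² - ‖Y‖²`
(`weight_sub_weight_mixed`). Preservation of norm therefore forces the exact intertwining `Bˢ W = Y
Aˢ`. A dual identity holds for `Z ↦ ∑ₛ Aˢ† Z Aˢ`.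

Existence: the overlap of the transformed state with the original on `kL` sites is `Tr Fᵏ`, with `F`
the product of mixed transfer matrices over one cell. By symmetry its modulus is that of `Tr
𝔼^{kL}`, which tends to 1, so `F` has an eigenvalue of modulus at least 1. Carried around the cell,
its eigenvector can never gain norm, so every step is an intertwining. The intertwiners are unitary
up to one common scalar because `V†V` is rigid.

Rigidity (`exists_eq_smul_one_of_chain`): if `Aˢ Yₙ = Yₙ₊₁ Aˢ` for all `n ≥ 0`, then `Y₀` is scalar,
by the spectral gap. Hence two families pushing the same operators through `A` differ by bond phases
(`exists_phase_of_pushThrough_eq`), and `mul_phase_eq` ties those phases to the push-through phases.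
Comparing `v_{j+1}(g)` with `v_j(T g)`, and `v_j(g) v_j(h)` with `v_j(gh)`, gives the second and
third claims.

Covariant phases: only the product of the phases around the cell is gauge invariant. It suffices to
find covariant phases with the correct product and absorb the rest into the bond unitaries. -/

noncomputable section

namespace ModulatedMPS

open Filter Topology

/-! ### Decay of matrix powers -/

section Spectral

attribute [local instance] Matrix.linftyOpNormedRing Matrix.linftyOpNormedAlgebra

/-- Powers of a matrix with spectral radius less than one tend to zero in trace. -/
theorem tendsto_trace_pow_zero {n : Type*} [Fintype n] [DecidableEq n] (M : Matrix n n ℂ)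
    (hM : ∀ μ : ℂ, Module.End.HasEigenvalue (Matrix.toLin' M) μ → ‖μ‖ < 1) :
    Tendsto (fun k : ℕ => (M ^ k).trace) atTop (𝓝 0) := by
  have hpow : Tendsto (fun k : ℕ => M ^ k) atTop (𝓝 0) := by
    rcases isEmpty_or_nonempty n with h | h
    · exact tendsto_const_nhds.congr fun k => Subsingleton.elim _ _
    have hr : spectralRadius ℂ M < (1 : NNReal) := by
      refine spectrum.spectralRadius_lt_of_forall_lt M fun μ hμ => ?_
      rw [← Matrix.spectrum_toLin', ← Module.End.hasEigenvalue_iff_mem_spectrum] at hμ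
      exact_mod_cast hM μ hμ
    -- By Gelfand's formula the norms of the powers are eventually below `c ^ k`, with `c` strictly
    -- between the spectral radius and 1.
    obtain ⟨c, hc, hc1⟩ := exists_between hr
    have hG := spectrum.pow_nnnorm_pow_one_div_tendsto_nhds_spectralRadius M
    have hlt : ∀ᶠ k : ℕ in atTop, (‖M ^ k‖₊ : ENNReal) ≤ c ^ k := by
      filter_upwards [hG.eventually_lt_const hc, eventually_gt_atTop 0] with k hk hk0
      have := ENNReal.rpow_le_rpow hk.le (Nat.cast_nonneg k)
      rw [← ENNReal.rpow_mul, one_div, inv_mul_cancel₀ (by positivity), ENNReal.rpow_one,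
        ENNReal.rpow_natCast] at this
      exact this
    have h0 : Tendsto (fun k : ℕ => (‖M ^ k‖₊ : ENNReal)) atTop (𝓝 0) :=
      tendsto_of_tendsto_of_tendsto_of_le_of_le' tendsto_const_nhds
        (ENNReal.tendsto_pow_atTop_nhds_zero_of_lt_one (by simpa using hc1))
        (Eventually.of_forall fun _ => zero_le) hlt
    refine tendsto_zero_iff_norm_tendsto_zero.2 ?_
    have := (ENNReal.tendsto_toReal ENNReal.zero_ne_top).comp h0
    simpa [Function.comp_def] using this
  have hc : Continuous fun X : Matrix n n ℂ => X.trace := continuous_id.matrix_trace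
  have h := (hc.tendsto 0).comp hpow
  rw [Matrix.trace_zero] at h
  exact h

end Spectral

/-! ### Transfer maps as contractions in the `ρ`-weighted norm -/

section Contraction

variable {d χ : ℕ}

/-- A vector on a doubled index, read as a matrix. -/
def unvec : (Fin χ × Fin χ → ℂ) ≃ₗ[ℂ] Matrix (Fin χ) (Fin χ) ℂ :=
  LinearEquiv.curry ℂ ℂ (Fin χ) (Fin χ)

/-- The mixed transfer matrix `∑ₛ Bˢ ⊗ (Aˢ)*`. -/
def mixedTransfer (B A : Fin d → Matrix (Fin χ) (Fin χ) ℂ) :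
    Matrix (Fin χ × Fin χ) (Fin χ × Fin χ) ℂ :=
  ∑ s, B s ⊗ₖ (A s).map (starRingEnd ℂ)

theorem transferMatrix_eq_mixedTransfer (A : Fin d → Matrix (Fin χ) (Fin χ) ℂ) :
    transferMatrix A = mixedTransfer A A := rfl

theorem unvec_mixedTransfer_mulVec (B A : Fin d → Matrix (Fin χ) (Fin χ) ℂ)
    (x : Fin χ × Fin χ → ℂ) :
    unvec (mixedTransfer B A *ᵥ x) = ∑ s, B s * unvec x * (A s)ᴴ := by
  rw [mixedTransfer, Matrix.sum_mulVec, map_sum]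
  refine Finset.sum_congr rfl fun s _ => ?_
  ext i j
  change ∑ p : Fin χ × Fin χ, B s i p.1 * star (A s j p.2) * x p = _
  simp only [Fintype.sum_prod_type, Matrix.mul_apply, Matrix.conjTranspose_apply, Finset.sum_mul]
  rw [Finset.sum_comm]
  refine Finset.sum_congr rfl fun k _ => Finset.sum_congr rfl fun l _ => ?_
  change B s i l * star (A s j k) * x (l, k) = B s i l * x (l, k) * star (A s j k)
  ring

/-- The squared weighted Hilbert-Schmidt norm `Tr (W ρ W†)`. -/
def weight (ρ W : Matrix (Fin χ) (Fin χ) ℂ) : ℝ := (W * ρ * Wᴴ).trace.re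

variable {ρ : Matrix (Fin χ) (Fin χ) ℂ}

theorem weight_nonneg (hρ : ρ.PosDef) (W : Matrix (Fin χ) (Fin χ) ℂ) : 0 ≤ weight ρ W :=
  (Complex.le_def.1 (hρ.posSemidef.mul_mul_conjTranspose_same W).trace_nonneg).1

theorem eq_zero_of_weight_eq_zero (hρ : ρ.PosDef) {W : Matrix (Fin χ) (Fin χ) ℂ}
    (hW : weight ρ W = 0) : W = 0 := by
  have hps := hρ.posSemidef.mul_mul_conjTranspose_same W
  have h0 : (W * ρ * Wᴴ).trace = 0 :=
    Complex.ext hW (Complex.le_def.1 hps.trace_nonneg).2.symm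
  rw [hps.trace_eq_zero_iff] at h0
  have hv : ∀ x, Wᴴ *ᵥ x = 0 := by
    intro x
    by_contra hx
    have h1 := hρ.dotProduct_mulVec_pos hx
    have h2 : star (Wᴴ *ᵥ x) ⬝ᵥ ρ *ᵥ (Wᴴ *ᵥ x) = star x ⬝ᵥ ((W * ρ * Wᴴ) *ᵥ x) := by
      rw [Matrix.star_mulVec, Matrix.conjTranspose_conjTranspose, ← Matrix.dotProduct_mulVec,
        Matrix.mulVec_mulVec, Matrix.mulVec_mulVec]
    rw [h2, h0] at h1
    simp at h1
  have : Wᴴ = 0 := Matrix.ext_of_mulVec_single fun i => by rw [hv, Matrix.zero_mulVec]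
  simpa using this

theorem weight_smul (c : ℂ) (W : Matrix (Fin χ) (Fin χ) ℂ) :
    weight ρ (c • W) = ‖c‖ ^ 2 * weight ρ W := by
  have : (c • W * ρ * (c • W)ᴴ).trace = (‖c‖ ^ 2 : ℝ) * (W * ρ * Wᴴ).trace := by
    simp only [Matrix.conjTranspose_smul, Matrix.smul_mul, Matrix.mul_smul, Matrix.trace_smul,
      smul_eq_mul, ← mul_assoc]
    rw [← Complex.normSq_eq_norm_sq, ← Complex.mul_conj]
    simp [mul_comm]
  rw [weight, this, Complex.re_ofReal_mul, weight]

/-- Cyclicity of the trace brings `Bˢ†Bˢ` together. This and `sum_weight_right` turn the two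
canonical conditions into isometry properties of the weighted norm. -/
theorem sum_weight_left {B : Fin d → Matrix (Fin χ) (Fin χ) ℂ} (hB : ∑ s, (B s)ᴴ * B s = 1)
    (W : Matrix (Fin χ) (Fin χ) ℂ) : ∑ s, weight ρ (B s * W) = weight ρ W := by
  have : ∀ s, (B s * W * ρ * (B s * W)ᴴ).trace = ((B s)ᴴ * B s * (W * ρ * Wᴴ)).trace := by
    intro s
    rw [Matrix.conjTranspose_mul, ← Matrix.mul_assoc, Matrix.trace_mul_comm]
    simp only [Matrix.mul_assoc]
  simp only [weight, this]
  rw [← Complex.re_sum, ← Matrix.trace_sum, ← Finset.sum_mul, hB, one_mul]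

theorem sum_weight_right {A : Fin d → Matrix (Fin χ) (Fin χ) ℂ}
    (hA : ∑ s, A s * ρ * (A s)ᴴ = ρ) (W : Matrix (Fin χ) (Fin χ) ℂ) :
    ∑ s, weight ρ (W * A s) = weight ρ W := by
  have : ∀ s, W * A s * ρ * (W * A s)ᴴ = W * (A s * ρ * (A s)ᴴ) * Wᴴ := by
    intro s
    simp only [Matrix.conjTranspose_mul, Matrix.mul_assoc]
  simp only [weight, this]
  rw [← Complex.re_sum, ← Matrix.trace_sum, ← Finset.sum_mul, ← Finset.mul_sum, hA]

theorem weight_sub (hρ : ρ.PosDef) (X Y : Matrix (Fin χ) (Fin χ) ℂ) :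
    weight ρ (X - Y) = weight ρ X + weight ρ Y - 2 * (X * ρ * Yᴴ).trace.re := by
  have h : (Y * ρ * Xᴴ).trace.re = (X * ρ * Yᴴ).trace.re := by
    have : (Y * ρ * Xᴴ) = (X * ρ * Yᴴ)ᴴ := by
      simp [Matrix.conjTranspose_mul, Matrix.mul_assoc, hρ.isHermitian.eq]
    rw [this, Matrix.trace_conjTranspose]
    simp
  simp only [weight, Matrix.conjTranspose_sub, Matrix.sub_mul, Matrix.mul_sub, Matrix.trace_sub,
    Complex.sub_re]
  linarith

/-- The defect in the contraction property of `W ↦ ∑ₛ Bˢ W ρ Aˢ† ρ⁻¹`. -/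
theorem weight_sub_weight_mixed (hρ : ρ.PosDef) {B A : Fin d → Matrix (Fin χ) (Fin χ) ℂ}
    (hB : ∑ s, (B s)ᴴ * B s = 1) (hA : ∑ s, A s * ρ * (A s)ᴴ = ρ)
    {W Y : Matrix (Fin χ) (Fin χ) ℂ} (hY : ∑ s, B s * (W * ρ) * (A s)ᴴ = Y * ρ) :
    ∑ s, weight ρ (B s * W - Y * A s) = weight ρ W - weight ρ Y := by
  have hc : ∑ s, (B s * W * ρ * (Y * A s)ᴴ).trace.re = weight ρ Y := by
    have : ∀ s, B s * W * ρ * (Y * A s)ᴴ = B s * (W * ρ) * (A s)ᴴ * Yᴴ := by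
      intro s
      simp only [Matrix.conjTranspose_mul, Matrix.mul_assoc]
    simp only [this]
    rw [← Complex.re_sum, ← Matrix.trace_sum, ← Finset.sum_mul, hY, weight]
  simp only [weight_sub hρ]
  rw [Finset.sum_sub_distrib, Finset.sum_add_distrib, sum_weight_left hB, sum_weight_right hA,
    ← Finset.mul_sum, hc]
  ring

/-- The defect in the contraction property of `Z ↦ ∑ₛ Aˢ† Z Aˢ`. -/
theorem weight_sub_weight_dual (hρ : ρ.PosDef) {A : Fin d → Matrix (Fin χ) (Fin χ) ℂ}
    (hA1 : ∑ s, (A s)ᴴ * A s = 1) (hA : ∑ s, A s * ρ * (A s)ᴴ = ρ)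
    {Z Y : Matrix (Fin χ) (Fin χ) ℂ} (hY : ∑ s, (A s)ᴴ * Z * A s = Y) :
    ∑ s, weight ρ (Z * A s - A s * Y) = weight ρ Z - weight ρ Y := by
  have hc : ∑ s, (Z * A s * ρ * (A s * Y)ᴴ).trace.re = weight ρ Y := by
    have : ∀ s, (Z * A s * ρ * (A s * Y)ᴴ).trace = ((A s)ᴴ * Z * A s * (ρ * Yᴴ)).trace := by
      intro s
      rw [Matrix.conjTranspose_mul, ← Matrix.mul_assoc, Matrix.trace_mul_comm]
      simp only [Matrix.mul_assoc]
    simp only [this]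
    rw [← Complex.re_sum, ← Matrix.trace_sum, ← Finset.sum_mul, hY, weight, Matrix.mul_assoc]
  simp only [weight_sub hρ]
  rw [Finset.sum_sub_distrib, Finset.sum_add_distrib, sum_weight_left hA1, sum_weight_right hA,
    ← Finset.mul_sum, hc]
  ring

theorem eq_of_sum_weight_sub_eq_zero (hρ : ρ.PosDef) {X Y : Fin d → Matrix (Fin χ) (Fin χ) ℂ}
    (h : ∑ s, weight ρ (X s - Y s) = 0) (s : Fin d) : X s = Y s := by
  rw [Finset.sum_eq_zero_iff_of_nonneg fun s _ => weight_nonneg hρ _] at h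
  exact sub_eq_zero.1 (eq_zero_of_weight_eq_zero hρ (h s (Finset.mem_univ s)))

end Contraction

/-! ### Spectrum of the transfer matrix and rigidity of intertwining chains -/

section Rigidity

theorem hasEigenvalue_toLin'_iff {n : Type*} [Fintype n] [DecidableEq n] {M : Matrix n n ℂ}
    {μ : ℂ} : Module.End.HasEigenvalue (Matrix.toLin' M) μ ↔ ∃ x, x ≠ 0 ∧ M *ᵥ x = μ • x := by
  constructor
  · intro h
    obtain ⟨x, hx⟩ := h.exists_hasEigenvector
    exact ⟨x, hx.2, by simpa using hx.apply_eq_smul⟩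
  · rintro ⟨x, hx, h⟩
    exact Module.End.hasEigenvalue_of_hasEigenvector
      ⟨Module.End.mem_eigenspace_iff.2 (by simpa using h), hx⟩

variable {d χ : ℕ} {A : Fin d → Matrix (Fin χ) (Fin χ) ℂ} {ρ : Matrix (Fin χ) (Fin χ) ℂ}

theorem isUnit_det_of_posDef (hρ : ρ.PosDef) : IsUnit ρ.det :=
  isUnit_iff_ne_zero.2 hρ.det_pos.ne'

/-- In the variable `W = x ρ⁻¹` the transfer matrix is a contraction, and an eigenvector has its
weight multiplied by `‖μ‖ ^ 2`. -/
theorem norm_le_one_of_hasEigenvalue (hρ : ρ.PosDef) (hA1 : ∑ s, (A s)ᴴ * A s = 1)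
    (hA : ∑ s, A s * ρ * (A s)ᴴ = ρ) {μ : ℂ}
    (hμ : Module.End.HasEigenvalue (Matrix.toLin' (transferMatrix A)) μ) : ‖μ‖ ≤ 1 := by
  obtain ⟨x, hx, h⟩ := hasEigenvalue_toLin'_iff.1 hμ
  have hu := isUnit_det_of_posDef hρ
  set W := unvec x * ρ⁻¹ with hW
  have hWρ : W * ρ = unvec x := by rw [hW, Matrix.nonsing_inv_mul_cancel_right _ _ hu]
  have hW0 : W ≠ 0 := by
    intro h0
    rw [h0, zero_mul] at hWρ
    exact hx (by simpa using hWρ.symm)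
  have hpos : 0 < weight ρ W :=
    (weight_nonneg hρ W).lt_of_ne' fun h0 => hW0 (eq_zero_of_weight_eq_zero hρ h0)
  have hY : ∑ s, A s * (W * ρ) * (A s)ᴴ = (μ • W) * ρ := by
    rw [hWρ, ← unvec_mixedTransfer_mulVec, ← transferMatrix_eq_mixedTransfer, h, map_smul,
      Matrix.smul_mul, hWρ]
  have hle : 0 ≤ weight ρ W - weight ρ (μ • W) := by
    rw [← weight_sub_weight_mixed hρ hA1 hA hY]
    exact Finset.sum_nonneg fun s _ => weight_nonneg hρ _
  rw [weight_smul] at hle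
  have : ‖μ‖ ^ 2 ≤ 1 := by
    by_contra! hc
    nlinarith
  exact (sq_le_one_iff₀ (norm_nonneg μ)).1 this

/-- The spectral content of injectivity for a tensor in left-canonical form: the only fixed points
of the transfer matrix are the multiples of `ρ`, and all eigenvalues other than one are strictly
inside the unit disc. -/
theorem IsInjective.spectral (hinj : IsInjective A) (hρ : ρ.PosDef)
    (hA1 : ∑ s, (A s)ᴴ * A s = 1) (hA : ∑ s, A s * ρ * (A s)ᴴ = ρ) :
    0 < χ ∧ (∀ x, transferMatrix A *ᵥ x = x → ∃ c : ℂ, unvec x = c • ρ) ∧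
      ∀ μ : ℂ, Module.End.HasEigenvalue (Matrix.toLin' (transferMatrix A)) μ → μ ≠ 1 →
        ‖μ‖ < 1 := by
  obtain ⟨μ₀, hfin, hgap⟩ := hinj
  have hχ : 0 < χ := by
    rcases Nat.eq_zero_or_pos χ with rfl | h
    · rw [Module.finrank_zero_of_subsingleton] at hfin
      simp at hfin
    · exact h
  have : Nonempty (Fin χ) := ⟨⟨0, hχ⟩⟩
  have hρ0 : ρ ≠ 0 := fun h => by
    have := hρ.trace_pos
    rw [h] at this
    simp at this
  have hfix : transferMatrix A *ᵥ unvec.symm ρ = unvec.symm ρ := by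
    apply unvec.injective
    rw [transferMatrix_eq_mixedTransfer, unvec_mixedTransfer_mulVec]
    simpa using hA
  have h1 : Module.End.HasEigenvalue (Matrix.toLin' (transferMatrix A)) 1 :=
    hasEigenvalue_toLin'_iff.2 ⟨unvec.symm ρ, by simpa using hρ0, by simpa using hfix⟩
  -- Since `ρ` gives the eigenvalue 1, a different dominant eigenvalue would have modulus above 1,
  -- against the contraction bound.
  have hμ₀ : μ₀ = 1 := by
    by_contra hne
    have hlt := hgap 1 h1 (Ne.symm hne)
    have hev : Module.End.HasEigenvalue (Matrix.toLin' (transferMatrix A)) μ₀ := by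
      rw [Module.End.hasEigenvalue_iff]
      intro hbot
      rw [hbot, finrank_bot] at hfin
      exact zero_ne_one hfin
    have := norm_le_one_of_hasEigenvalue hρ hA1 hA hev
    rw [norm_one] at hlt
    linarith
  subst hμ₀
  refine ⟨hχ, fun x hx => ?_, fun μ hμ hne => by simpa using hgap μ hμ hne⟩
  have hmem : ∀ y, transferMatrix A *ᵥ y = y →
      y ∈ Module.End.eigenspace (Matrix.toLin' (transferMatrix A)) 1 := fun y hy =>
    Module.End.mem_eigenspace_iff.2 (by simpa using hy)
  obtain ⟨c, hc⟩ := (finrank_eq_one_iff_of_nonzero' (⟨unvec.symm ρ, hmem _ hfix⟩ :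
    Module.End.eigenspace (Matrix.toLin' (transferMatrix A)) 1)
    (fun h => hρ0 (by simpa using congrArg Subtype.val h))).1 hfin ⟨x, hmem x hx⟩
  refine ⟨c, ?_⟩
  have := congrArg (fun y => unvec (Subtype.val y)) hc
  simpa using this.symm

theorem trace_unvec_transferMatrix_mulVec (hA1 : ∑ s, (A s)ᴴ * A s = 1)
    (x : Fin χ × Fin χ → ℂ) :
    (unvec (transferMatrix A *ᵥ x)).trace = (unvec x).trace := by
  rw [transferMatrix_eq_mixedTransfer, unvec_mixedTransfer_mulVec, Matrix.trace_sum]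
  have : ∀ s, (A s * unvec x * (A s)ᴴ).trace = ((A s)ᴴ * A s * unvec x).trace := fun s => by
    rw [Matrix.trace_mul_comm, Matrix.mul_assoc]
  simp only [this]
  rw [← Matrix.trace_sum, ← Finset.sum_mul, hA1, one_mul]

/-- A one-sided chain of matrices intertwined by an injective tensor starts at a scalar. -/
theorem exists_eq_smul_one_of_chain (hinj : IsInjective A) (hρ : ρ.PosDef)
    (hA1 : ∑ s, (A s)ᴴ * A s = 1) (hA : ∑ s, A s * ρ * (A s)ᴴ = ρ)
    (Y : ℕ → Matrix (Fin χ) (Fin χ) ℂ) (hY : ∀ n s, A s * Y n = Y (n + 1) * A s) :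
    ∃ c : ℂ, Y 0 = c • 1 := by
  obtain ⟨hχ, hfix, hgap⟩ := hinj.spectral hρ hA1 hA
  have : Nonempty (Fin χ) := ⟨⟨0, hχ⟩⟩
  have hu := isUnit_det_of_posDef hρ
  have htr : ρ.trace ≠ 0 := hρ.trace_pos.ne'
  have hstep : ∀ Z : ℕ → Matrix (Fin χ) (Fin χ) ℂ, (∀ n s, A s * Z n = Z (n + 1) * A s) →
      ∑ s, A s * (Z 0 * ρ) * (A s)ᴴ = Z 1 * ρ := by
    intro Z hZ
    have : ∀ s, A s * (Z 0 * ρ) * (A s)ᴴ = Z 1 * (A s * ρ * (A s)ᴴ) := fun s => by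
      rw [← Matrix.mul_assoc, hZ 0 s]
      simp only [Matrix.mul_assoc, zero_add]
    simp only [this]
    rw [← Finset.mul_sum, hA]
  -- The traceless starting points `Z 0 * ρ` of chains. The transfer matrix shifts a chain by one
  -- step and preserves the trace, so `S` is invariant; an eigenvector in it would contradict the
  -- gap.
  let S : Submodule ℂ (Fin χ × Fin χ → ℂ) :=
    { carrier := {x | (unvec x).trace = 0 ∧ ∃ Z : ℕ → Matrix (Fin χ) (Fin χ) ℂ,
        (∀ n s, A s * Z n = Z (n + 1) * A s) ∧ unvec x = Z 0 * ρ}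
      add_mem' := by
        rintro x y ⟨hx, Z, hZ, hxZ⟩ ⟨hy, Z', hZ', hyZ⟩
        refine ⟨by simp [hx, hy], fun n => Z n + Z' n, fun n s => ?_, ?_⟩
        · rw [Matrix.mul_add, Matrix.add_mul, hZ, hZ']
        · rw [map_add, hxZ, hyZ, Matrix.add_mul]
      zero_mem' := ⟨by simp, fun _ => 0, by simp, by simp⟩
      smul_mem' := by
        rintro c x ⟨hx, Z, hZ, hxZ⟩
        refine ⟨by simp [hx], fun n => c • Z n, fun n s => ?_, ?_⟩
        · rw [Matrix.mul_smul, Matrix.smul_mul, hZ]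
        · rw [map_smul, hxZ, Matrix.smul_mul] }
  have hinv : ∀ x ∈ S, Matrix.toLin' (transferMatrix A) x ∈ S := by
    rintro x ⟨hx, Z, hZ, hxZ⟩
    rw [Matrix.toLin'_apply]
    refine ⟨by rw [trace_unvec_transferMatrix_mulVec hA1, hx], fun n => Z (n + 1),
      fun n s => hZ (n + 1) s, ?_⟩
    rw [transferMatrix_eq_mixedTransfer, unvec_mixedTransfer_mulVec, hxZ, hstep Z hZ]
  have hS : S = ⊥ := by
    by_contra hne
    have : Nontrivial S := Submodule.nontrivial_iff_ne_bot.2 hne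
    obtain ⟨μ, hμ⟩ := Module.End.exists_eigenvalue ((Matrix.toLin' (transferMatrix A)).restrict hinv)
    obtain ⟨⟨x, hxS⟩, hx⟩ := hμ.exists_hasEigenvector
    have hx0 : x ≠ 0 := fun h => hx.2 (Subtype.ext h)
    have hEx : transferMatrix A *ᵥ x = μ • x := by
      simpa using congrArg Subtype.val hx.apply_eq_smul
    obtain ⟨htx, Z, hZ, hxZ⟩ := hxS
    have hZ0 : Z 0 ≠ 0 := fun h => hx0 (by simpa [h] using hxZ)
    have hpos : 0 < weight ρ (Z 0) :=
      (weight_nonneg hρ _).lt_of_ne' fun h0 => hZ0 (eq_zero_of_weight_eq_zero hρ h0)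
    have hZ1 : Z 1 = μ • Z 0 := by
      have h1 : Z 1 * ρ = (μ • Z 0) * ρ := by
        rw [← hstep Z hZ, ← hxZ, ← unvec_mixedTransfer_mulVec, ← transferMatrix_eq_mixedTransfer,
          hEx, map_smul, hxZ, Matrix.smul_mul]
      simpa [Matrix.mul_nonsing_inv_cancel_right _ _ hu] using congrArg (· * ρ⁻¹) h1
    -- Both weights equal the total weight of `A s * Z 0 = Z 1 * A s`, so the eigenvalue is
    -- unimodular and the gap makes it 1.
    have hw : weight ρ (Z 1) = weight ρ (Z 0) := by
      rw [← sum_weight_right hA (Z 1), ← sum_weight_left hA1 (Z 0)]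
      exact Finset.sum_congr rfl fun s _ => by rw [hZ 0 s]
    rw [hZ1, weight_smul] at hw
    have hμ1 : ‖μ‖ ^ 2 = 1 := mul_right_cancel₀ hpos.ne' (by rw [hw, one_mul])
    have hμn : ‖μ‖ = 1 := (pow_eq_one_iff_of_nonneg (norm_nonneg μ) two_ne_zero).1 hμ1
    have hμ1 : μ = 1 := by
      by_contra hne1
      have := hgap μ (hasEigenvalue_toLin'_iff.2 ⟨x, hx0, hEx⟩) hne1
      linarith
    obtain ⟨c, hc⟩ := hfix x (by rw [hEx, hμ1, one_smul])
    rw [hc, Matrix.trace_smul, smul_eq_mul, mul_eq_zero, or_iff_left htr] at htx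
    exact hx0 (by simpa [htx] using hc)
  set c := (Y 0 * ρ).trace / ρ.trace with hc
  have hmem : unvec.symm ((Y 0 - c • 1) * ρ) ∈ S := by
    refine ⟨?_, fun n => Y n - c • 1, fun n s => ?_, by simp⟩
    · rw [LinearEquiv.apply_symm_apply, Matrix.sub_mul, Matrix.trace_sub, Matrix.smul_mul, one_mul,
        Matrix.trace_smul, smul_eq_mul, hc, div_mul_cancel₀ _ htr, sub_self]
    · rw [Matrix.mul_sub, Matrix.sub_mul, hY]
      simp
  rw [hS, Submodule.mem_bot, LinearEquiv.map_eq_zero_iff] at hmem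
  refine ⟨c, sub_eq_zero.1 ?_⟩
  simpa [Matrix.mul_nonsing_inv_cancel_right _ _ hu] using congrArg (· * ρ⁻¹) hmem

/-- The norm of the periodic matrix product state tends to one. -/
theorem tendsto_trace_transferMatrix_pow (hinj : IsInjective A) (hρ : ρ.PosDef)
    (hA1 : ∑ s, (A s)ᴴ * A s = 1) (hA : ∑ s, A s * ρ * (A s)ᴴ = ρ) :
    Tendsto (fun k : ℕ => (transferMatrix A ^ k).trace) atTop (𝓝 1) := by
  obtain ⟨hχ, hfix, hgap⟩ := hinj.spectral hρ hA1 hA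
  have : Nonempty (Fin χ) := ⟨⟨0, hχ⟩⟩
  have htr : ρ.trace ≠ 0 := hρ.trace_pos.ne'
  set E := transferMatrix A with hE
  -- The spectral projection onto the fixed line: right fixed vector `ρ`, left fixed vector the
  -- identity, normalized to trace 1. What remains, `E - P`, has all eigenvalues inside the unit
  -- disc.
  let P : Matrix (Fin χ × Fin χ) (Fin χ × Fin χ) ℂ :=
    Matrix.vecMulVec (ρ.trace⁻¹ • unvec.symm ρ) (unvec.symm 1)
  have hPx : ∀ x, P *ᵥ x = ((unvec x).trace / ρ.trace) • unvec.symm ρ := by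
    intro x
    have h1 : unvec.symm (1 : Matrix (Fin χ) (Fin χ) ℂ) ⬝ᵥ x = (unvec x).trace := by
      rw [dotProduct, Fintype.sum_prod_type, Matrix.trace]
      refine Finset.sum_congr rfl fun i _ => ?_
      change ∑ j, (1 : Matrix (Fin χ) (Fin χ) ℂ) i j * x (i, j) = x (i, i)
      simp [Matrix.one_apply]
    rw [Matrix.vecMulVec_mulVec, h1]
    ext i
    simp [div_eq_mul_inv, mul_comm, mul_left_comm, mul_assoc]
  have hEρ : E *ᵥ unvec.symm ρ = unvec.symm ρ := by
    apply unvec.injective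
    rw [hE, transferMatrix_eq_mixedTransfer, unvec_mixedTransfer_mulVec]
    simpa using hA
  have hEP : E * P = P := by
    refine Matrix.ext_of_mulVec_single fun i => ?_
    rw [← Matrix.mulVec_mulVec, hPx, Matrix.mulVec_smul, hEρ]
  have hPE : P * E = P := by
    refine Matrix.ext_of_mulVec_single fun i => ?_
    rw [← Matrix.mulVec_mulVec, hPx, hPx, trace_unvec_transferMatrix_mulVec hA1]
  have hPP : P * P = P := by
    refine Matrix.ext_of_mulVec_single fun i => ?_
    rw [← Matrix.mulVec_mulVec, hPx (Pi.single i 1), Matrix.mulVec_smul, hPx]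
    simp [htr]
  have hPtr : P.trace = 1 := by
    have : P.trace = ρ.trace⁻¹ * (unvec.symm ρ ⬝ᵥ unvec.symm 1) := by
      simp [P, Matrix.trace_vecMulVec]
    rw [this, dotProduct, Fintype.sum_prod_type]
    have : ∀ i : Fin χ, ∑ j : Fin χ, unvec.symm ρ (i, j) * unvec.symm 1 (i, j) = ρ i i := by
      intro i
      change ∑ j, ρ i j * (1 : Matrix (Fin χ) (Fin χ) ℂ) i j = ρ i i
      simp [Matrix.one_apply]
    simp only [this]
    exact inv_mul_cancel₀ htr
  have hpow : ∀ k : ℕ, E ^ (k + 1) = (E - P) ^ (k + 1) + P := by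
    intro k
    induction k with
    | zero => simp
    | succ k ih =>
      have hPk : P * (E - P) ^ (k + 1) = 0 := by
        rw [pow_succ', ← mul_assoc, mul_sub, hPE, hPP, sub_self, zero_mul]
      rw [pow_succ' E, ih, mul_add, hEP, pow_succ' (E - P) (k + 1), sub_mul, hPk, sub_zero]
  have hN : Tendsto (fun k : ℕ => ((E - P) ^ k).trace) atTop (𝓝 0) := by
    refine tendsto_trace_pow_zero _ fun μ hμ => ?_
    obtain ⟨x, hx, h⟩ := hasEigenvalue_toLin'_iff.1 hμ
    by_cases hμ0 : μ = 0
    · simp [hμ0]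
    have hPx0 : P *ᵥ x = 0 := by
      have : P *ᵥ ((E - P) *ᵥ x) = 0 := by
        rw [Matrix.mulVec_mulVec, mul_sub, hPE, hPP, sub_self, Matrix.zero_mulVec]
      rw [h, Matrix.mulVec_smul] at this
      exact (smul_eq_zero.1 this).resolve_left hμ0
    have hEx : E *ᵥ x = μ • x := by
      rw [← h, Matrix.sub_mulVec, hPx0, sub_zero]
    refine hgap μ (hasEigenvalue_toLin'_iff.2 ⟨x, hx, hEx⟩) ?_
    rintro rfl
    obtain ⟨c, hc⟩ := hfix x (by rw [hEx, one_smul])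
    rw [hPx, hc, Matrix.trace_smul, smul_eq_mul, mul_div_cancel_right₀ _ htr, ← map_smul, ← hc,
      LinearEquiv.symm_apply_apply] at hPx0
    exact hx hPx0
  have hlim := hN.add_const (1 : ℂ)
  rw [zero_add] at hlim
  refine hlim.congr' ?_
  filter_upwards [eventually_gt_atTop 0] with k hk
  obtain ⟨m, rfl⟩ := Nat.exists_eq_succ_of_ne_zero hk.ne'
  rw [Nat.succ_eq_add_one, hpow m, Matrix.trace_add, hPtr]

end Rigidity

/-! ### Overlaps of matrix product states as traces of transfer matrices -/

section Overlap

theorem list_prod_ofFn_sum {R : Type*} [Semiring R] {d : ℕ} :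
    ∀ {n : ℕ} (M : Fin n → Fin d → R), (List.ofFn fun j => ∑ s, M j s).prod =
      ∑ s : Fin n → Fin d, (List.ofFn fun j => M j (s j)).prod
  | 0, M => by simp
  | n + 1, M => by
    rw [List.ofFn_succ, List.prod_cons, list_prod_ofFn_sum fun j => M j.succ,
      ← (Fin.consEquiv fun _ => Fin d).sum_comp, Fintype.sum_prod_type, Finset.sum_mul_sum]
    refine Finset.sum_congr rfl fun a _ => Finset.sum_congr rfl fun s _ => ?_
    simp [Fin.consEquiv, List.ofFn_succ]

theorem list_prod_ofFn_smul {R : Type*} [Ring R] [Algebra ℂ R] :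
    ∀ {n : ℕ} (c : Fin n → ℂ) (M : Fin n → R), (List.ofFn fun j => c j • M j).prod =
      (∏ j, c j) • (List.ofFn M).prod
  | 0, _, _ => by simp
  | n + 1, c, M => by
    rw [List.ofFn_succ, List.prod_cons, list_prod_ofFn_smul (fun j => c j.succ) fun j => M j.succ,
      List.ofFn_succ, List.prod_cons, Fin.prod_univ_succ, smul_mul_smul_comm]

theorem list_prod_ofFn_kronecker {m : Type*} [Fintype m] [DecidableEq m] :
    ∀ {n : ℕ} (X Y : Fin n → Matrix m m ℂ), (List.ofFn fun j => X j ⊗ₖ Y j).prod =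
      (List.ofFn X).prod ⊗ₖ (List.ofFn Y).prod
  | 0, _, _ => by simp
  | n + 1, X, Y => by
    rw [List.ofFn_succ, List.prod_cons, list_prod_ofFn_kronecker (fun j => X j.succ) fun j =>
      Y j.succ, List.ofFn_succ, List.prod_cons, List.ofFn_succ, List.prod_cons,
      Matrix.mul_kronecker_mul]

theorem list_prod_ofFn_periodic {R : Type*} [Monoid R] {L : ℕ} (f : ZMod L → R) (k : ℕ) :
    (List.ofFn fun j : Fin (k * L) => f ((j : ℕ) : ZMod L)).prod =
      (List.ofFn fun j : Fin L => f ((j : ℕ) : ZMod L)).prod ^ k := by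
  rw [List.ofFn_mul]
  simp

variable {d χ : ℕ}

/-- The action of an operator on the physical index of a tensor. -/
def siteAct (W : Matrix (Fin d) (Fin d) ℂ) (A : Fin d → Matrix (Fin χ) (Fin χ) ℂ) (s : Fin d) :
    Matrix (Fin χ) (Fin χ) ℂ :=
  ∑ t, W s t • A t

theorem siteAct_mul (W W' : Matrix (Fin d) (Fin d) ℂ) (A : Fin d → Matrix (Fin χ) (Fin χ) ℂ) :
    siteAct (W * W') A = siteAct W (siteAct W' A) := by
  ext1 s
  simp only [siteAct, Matrix.mul_apply, Finset.sum_smul, Finset.smul_sum, smul_smul]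
  exact Finset.sum_comm

theorem siteAct_smul (c : ℂ) (W : Matrix (Fin d) (Fin d) ℂ)
    (A : Fin d → Matrix (Fin χ) (Fin χ) ℂ) (s : Fin d) :
    siteAct (c • W) A s = c • siteAct W A s := by
  simp [siteAct, Finset.smul_sum, smul_smul]

theorem siteAct_smul_mul_mul (W : Matrix (Fin d) (Fin d) ℂ)
    (A : Fin d → Matrix (Fin χ) (Fin χ) ℂ) (c : ℂ) (X Y : Matrix (Fin χ) (Fin χ) ℂ) (s : Fin d) :
    siteAct W (fun t => c • (X * A t * Y)) s = c • (X * siteAct W A s * Y) := by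
  simp only [siteAct, Finset.mul_sum, Finset.sum_mul, Finset.smul_sum, Matrix.mul_smul,
    Matrix.smul_mul]
  exact Finset.sum_congr rfl fun t _ => smul_comm _ _ _

theorem sum_conjTranspose_siteAct_mul (W : Matrix.unitaryGroup (Fin d) ℂ)
    {A : Fin d → Matrix (Fin χ) (Fin χ) ℂ} (hA1 : ∑ s, (A s)ᴴ * A s = 1) :
    ∑ s, (siteAct (W : Matrix (Fin d) (Fin d) ℂ) A s)ᴴ * siteAct (W : Matrix (Fin d) (Fin d) ℂ) A s
      = 1 := by
  rw [← hA1]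
  have hW : (W : Matrix (Fin d) (Fin d) ℂ)ᴴ * W = 1 := Matrix.UnitaryGroup.star_mul_self W
  simp only [siteAct, Matrix.conjTranspose_sum, Matrix.conjTranspose_smul, Finset.sum_mul_sum,
    smul_mul_smul_comm]
  rw [Finset.sum_comm]
  refine Finset.sum_congr rfl fun t _ => ?_
  rw [Finset.sum_comm]
  simp only [← Finset.sum_smul]
  have : ∀ u, ∑ s, star (W.1 s t) * W.1 s u = (1 : Matrix (Fin d) (Fin d) ℂ) t u := fun u => by
    rw [← hW, Matrix.mul_apply]
    rfl
  simp only [this, Matrix.one_apply, ite_smul, one_smul, zero_smul]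
  simp

/-- A product of two traces is the trace of a Kronecker product, and the sum over configurations
then distributes over the sites. -/
theorem sum_trace_mul_star_trace {n : ℕ} (B : Fin n → Fin d → Matrix (Fin χ) (Fin χ) ℂ)
    (A : Fin d → Matrix (Fin χ) (Fin χ) ℂ) :
    ∑ s : Fin n → Fin d, (List.ofFn fun j => B j (s j)).prod.trace *
      starRingEnd ℂ (List.ofFn fun j => A (s j)).prod.trace =
      (List.ofFn fun j => mixedTransfer (B j) A).prod.trace := by
  simp only [mixedTransfer]
  rw [list_prod_ofFn_sum fun j s => B j s ⊗ₖ (A s).map (starRingEnd ℂ), Matrix.trace_sum]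
  refine Finset.sum_congr rfl fun s _ => ?_
  rw [list_prod_ofFn_kronecker, Matrix.trace_kronecker]
  congr 1
  have : (List.ofFn fun j => (A (s j)).map (starRingEnd ℂ)).prod =
      (starRingEnd ℂ).mapMatrix (List.ofFn fun j => A (s j)).prod := by
    rw [map_list_prod, List.map_ofFn]
    rfl
  rw [this]
  simp [Matrix.trace, map_sum]

theorem chainOp_mulVec_mpsState {G : Type*} [Group G] {L : ℕ}
    (U : ZMod L → G →* Matrix.unitaryGroup (Fin d) ℂ) (A : Fin d → Matrix (Fin χ) (Fin χ) ℂ)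
    (n : ℕ) (g : G) (s : Fin n → Fin d) :
    (chainOp U n g *ᵥ mpsState A n) s = (List.ofFn fun j : Fin n =>
      siteAct (U ((j : ℕ) : ZMod L) g : Matrix (Fin d) (Fin d) ℂ) A (s j)).prod.trace := by
  simp only [siteAct]
  rw [list_prod_ofFn_sum fun (j : Fin n) t =>
    (U ((j : ℕ) : ZMod L) g : Matrix (Fin d) (Fin d) ℂ) (s j) t • A t, Matrix.trace_sum]
  simp only [list_prod_ofFn_smul, Matrix.trace_smul]
  rfl

/-- The mixed transfer matrices of a unit cell with a symmetric matrix product state have an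
eigenvalue which is not strictly inside the unit disc. -/
theorem exists_eigenvalue_one_le_norm {A : Fin d → Matrix (Fin χ) (Fin χ) ℂ}
    {ρ : Matrix (Fin χ) (Fin χ) ℂ} (hinj : IsInjective A) (hρ : ρ.PosDef)
    (hA1 : ∑ s, (A s)ᴴ * A s = 1) (hA : ∑ s, A s * ρ * (A s)ᴴ = ρ)
    {G : Type*} [Group G] {L : ℕ} [NeZero L]
    (U : ZMod L → G →* Matrix.unitaryGroup (Fin d) ℂ) (g : G)
    (hsym : ∀ k : ℕ, 1 ≤ k → ∃ z : Circle,
      chainOp U (k * L) g *ᵥ mpsState A (k * L) = (z : ℂ) • mpsState A (k * L)) :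
    ∃ (μ : ℂ) (x : Fin χ × Fin χ → ℂ), 1 ≤ ‖μ‖ ∧ x ≠ 0 ∧
      (List.ofFn fun j : Fin L => mixedTransfer
        (siteAct (U ((j : ℕ) : ZMod L) g : Matrix (Fin d) (Fin d) ℂ) A) A).prod *ᵥ x = μ • x := by
  set F := (List.ofFn fun j : Fin L => mixedTransfer
    (siteAct (U ((j : ℕ) : ZMod L) g : Matrix (Fin d) (Fin d) ℂ) A) A).prod with hF
  -- Otherwise `Tr Fᵏ → 0`, while its modulus equals `|Tr 𝔼^{kL}| → 1`.
  by_contra! hcon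
  have hF0 : Tendsto (fun k : ℕ => (F ^ k).trace) atTop (𝓝 0) := by
    refine tendsto_trace_pow_zero F fun μ hμ => ?_
    obtain ⟨x, hx, h⟩ := hasEigenvalue_toLin'_iff.1 hμ
    by_contra! hle
    exact hcon μ x hle hx h
  have hnorm : ∀ k : ℕ, 1 ≤ k → ‖(F ^ k).trace‖ = ‖(transferMatrix A ^ (k * L)).trace‖ := by
    intro k hk
    obtain ⟨z, hz⟩ := hsym k hk
    have h1 : (F ^ k).trace = z * (transferMatrix A ^ (k * L)).trace := by
      rw [hF, ← list_prod_ofFn_periodic (fun j : ZMod L => mixedTransfer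
        (siteAct (U j g : Matrix (Fin d) (Fin d) ℂ) A) A) k, ← sum_trace_mul_star_trace]
      simp only [← chainOp_mulVec_mpsState, hz]
      have h2 : transferMatrix A ^ (k * L) =
          (List.ofFn fun _ : Fin (k * L) => mixedTransfer A A).prod := by
        rw [List.ofFn_const, List.prod_replicate, transferMatrix_eq_mixedTransfer]
      rw [h2, ← sum_trace_mul_star_trace (fun _ => A), Finset.mul_sum]
      refine Finset.sum_congr rfl fun s _ => ?_
      rw [Pi.smul_apply, smul_eq_mul, mul_assoc]
      rfl
    rw [h1, norm_mul, Circle.norm_coe, one_mul]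
  have hE := ((tendsto_trace_transferMatrix_pow hinj hρ hA1 hA).comp
    (tendsto_id.atTop_mul_const' (NeZero.pos L))).norm
  have hE' : Tendsto (fun k : ℕ => ‖(F ^ k).trace‖) atTop (𝓝 ‖(1 : ℂ)‖) := by
    refine hE.congr' ?_
    filter_upwards [eventually_ge_atTop 1] with k hk
    rw [hnorm k hk]
    rfl
  have := tendsto_nhds_unique hE' hF0.norm
  simp at this

end Overlap

/-! ### Existence of bond unitaries on one cell -/

section Existence

/-- A quantity that is monotone around a loop and does not end above its start cannot move; this
turns inequalities of weights into equalities. -/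
theorem eq_succ_of_le_succ_of_le {f : ℕ → ℝ} {L : ℕ} (h : ∀ n < L, f n ≤ f (n + 1))
    (hL : f L ≤ f 0) : ∀ n < L, f n = f (n + 1) := by
  have mono : ∀ n m, n ≤ m → m ≤ L → f n ≤ f m := by
    intro n m hnm
    induction m, hnm using Nat.le_induction with
    | base => exact fun _ => le_rfl
    | succ m _ ih => exact fun hm => (ih (by omega)).trans (h m (by omega))
  intro n hn
  have h1 := mono 0 n (Nat.zero_le _) hn.le
  have h2 := mono (n + 1) L hn le_rfl
  exact le_antisymm (h n hn) (by linarith)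

theorem val_add_one_eq_or {L : ℕ} [NeZero L] (j : ZMod L) :
    (j + 1).val = j.val + 1 ∨ (j + 1).val = 0 ∧ j.val + 1 = L := by
  have hj := j.val_lt
  rcases Nat.lt_or_ge (j.val + 1) L with h | h
  · left
    have : j + 1 = ((j.val + 1 : ℕ) : ZMod L) := by simp
    rw [this, ZMod.val_natCast_of_lt h]
  · right
    have hL : j.val + 1 = L := by omega
    have : j + 1 = ((j.val + 1 : ℕ) : ZMod L) := by simp
    rw [this, hL]
    simp

theorem apply_val_add_one {α : Type*} {L : ℕ} [NeZero L] {f : ℕ → α} (h : f 0 = f L) (j : ZMod L) :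
    f (j + 1).val = f (j.val + 1) := by
  rcases val_add_one_eq_or j with hj | ⟨hj, hj'⟩
  · rw [hj]
  · rw [hj, hj', h]

variable {d χ : ℕ} {A : Fin d → Matrix (Fin χ) (Fin χ) ℂ} {ρ : Matrix (Fin χ) (Fin χ) ℂ}

/-- A closed chain of matrices intertwining an injective tensor with isometric tensors
is unitary up to normalization. -/
theorem exists_conjTranspose_mul_self_eq (hinj : IsInjective A) (hρ : ρ.PosDef)
    (hA1 : ∑ s, (A s)ᴴ * A s = 1) (hA : ∑ s, A s * ρ * (A s)ᴴ = ρ) {L : ℕ} [NeZero L]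
    {B : ℕ → Fin d → Matrix (Fin χ) (Fin χ) ℂ} (hB : ∀ n, ∑ s, (B n s)ᴴ * B n s = 1)
    {V : ℕ → Matrix (Fin χ) (Fin χ) ℂ} (hV : ∀ n < L, ∀ s, B n s * V (n + 1) = V n * A s)
    {μ : ℂ} (hμ : ‖μ‖ = 1) (h0 : V 0 = μ • V L) (hne : V 0 ≠ 0) :
    ∃ r : ℝ, 0 < r ∧ ∀ n ≤ L, (V n)ᴴ * V n = ((r ^ 2 : ℝ) : ℂ) • 1 := by
  set Z : ℕ → Matrix (Fin χ) (Fin χ) ℂ := fun n => (V n)ᴴ * V n with hZ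
  have hZ0 : Z 0 = Z L := by
    simp only [hZ, h0, Matrix.conjTranspose_smul, smul_mul_smul_comm]
    have : star μ * μ = 1 := by
      rw [← starRingEnd_apply, mul_comm, Complex.mul_conj, Complex.normSq_eq_norm_sq, hμ]
      simp
    rw [this, one_smul]
  have hstep : ∀ n < L, ∑ s, (A s)ᴴ * Z n * A s = Z (n + 1) := by
    intro n hn
    have : ∀ s, (A s)ᴴ * Z n * A s = (V (n + 1))ᴴ * ((B n s)ᴴ * B n s) * V (n + 1) := by
      intro s
      have h1 : (A s)ᴴ * Z n * A s = (V n * A s)ᴴ * (V n * A s) := by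
        simp only [hZ, Matrix.conjTranspose_mul, Matrix.mul_assoc]
      rw [h1, ← hV n hn s]
      simp only [Matrix.conjTranspose_mul, Matrix.mul_assoc]
    simp only [this]
    rw [← Finset.sum_mul, ← Finset.mul_sum, hB, mul_one]
  have hdef := fun n (hn : n < L) => weight_sub_weight_dual hρ hA1 hA (hstep n hn)
  have hle : ∀ n < L, -weight ρ (Z n) ≤ -weight ρ (Z (n + 1)) := by
    intro n hn
    have : 0 ≤ weight ρ (Z n) - weight ρ (Z (n + 1)) := by
      rw [← hdef n hn]
      exact Finset.sum_nonneg fun s _ => weight_nonneg hρ _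
    linarith
  have heq := eq_succ_of_le_succ_of_le hle (by rw [hZ0])
  have hcomm : ∀ n < L, ∀ s, Z n * A s = A s * Z (n + 1) := by
    intro n hn s
    refine eq_of_sum_weight_sub_eq_zero hρ (X := fun s => Z n * A s)
      (Y := fun s => A s * Z (n + 1)) ?_ s
    rw [hdef n hn]
    linarith [heq n hn]
  -- The relation reads `A Zₙ₊₁ = Zₙ A`, so the chain runs backwards around the cell; `Z 0 = Z L`
  -- continues it indefinitely.
  obtain ⟨c, hc⟩ := exists_eq_smul_one_of_chain hinj hρ hA1 hA
    (fun n => Z (-(n : ZMod L)).val) (fun n s => by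
      have h1 := hcomm (-((n + 1 : ℕ) : ZMod L)).val (ZMod.val_lt _) s
      rw [← apply_val_add_one hZ0] at h1
      rw [h1]
      congr 4
      push_cast
      ring)
  have hc0 : Z 0 = c • 1 := by simpa using hc
  have hall : ∀ n ≤ L, Z n = c • 1 := by
    intro n
    induction n with
    | zero => exact fun _ => hc0
    | succ n ih =>
      intro hn
      rw [← hstep n hn, ih (by omega)]
      simp only [Matrix.mul_smul, Matrix.smul_mul, mul_one]
      rw [← Finset.smul_sum, hA1]
  have hχ := (hinj.spectral hρ hA1 hA).1
  have hcne : c ≠ 0 := by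
    rintro rfl
    rw [zero_smul] at hc0
    exact hne (Matrix.conjTranspose_mul_self_eq_zero.1 hc0)
  have hcnn : 0 ≤ c := by
    have h1 := (Matrix.posSemidef_conjTranspose_mul_self (V 0)).diag_nonneg (i := ⟨0, hχ⟩)
    have h2 : ((V 0)ᴴ * V 0) = c • 1 := hc0
    rw [h2] at h1
    simpa using h1
  obtain ⟨hre, him⟩ := Complex.le_def.1 hcnn
  have hcre : ((c.re : ℝ) : ℂ) = c := Complex.ext rfl him
  have hrepos : 0 < c.re := lt_of_le_of_ne hre fun h => hcne (by rw [← hcre, ← h]; simp)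
  refine ⟨Real.sqrt c.re, Real.sqrt_pos.2 hrepos, fun n hn => ?_⟩
  rw [Real.sq_sqrt hre, hcre]
  exact hall n hn

/-- The local action of a symmetry of the periodic matrix product state is pushed through the
tensor, with bond unitaries and phases that are periodic along the chain. -/
theorem exists_pushThrough_cell (hinj : IsInjective A) (hρ : ρ.PosDef)
    (hA1 : ∑ s, (A s)ᴴ * A s = 1) (hA : ∑ s, A s * ρ * (A s)ᴴ = ρ)
    {G : Type*} [Group G] {L : ℕ} [NeZero L]
    (U : ZMod L → G →* Matrix.unitaryGroup (Fin d) ℂ) (g : G)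
    (hsym : ∀ k : ℕ, 1 ≤ k → ∃ z : Circle,
      chainOp U (k * L) g *ᵥ mpsState A (k * L) = (z : ℂ) • mpsState A (k * L)) :
    ∃ (v : ZMod L → Matrix.unitaryGroup (Fin χ) ℂ) (p : ZMod L → Circle), ∀ j s,
      siteAct (U j g : Matrix (Fin d) (Fin d) ℂ) A s = (p j : ℂ) •
        ((v (j - 1) : Matrix (Fin χ) (Fin χ) ℂ)ᴴ * A s * (v j : Matrix (Fin χ) (Fin χ) ℂ)) := by
  obtain ⟨μ, x, hμ1, hx, hFx⟩ := exists_eigenvalue_one_le_norm hinj hρ hA1 hA U g hsym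
  have hu := isUnit_det_of_posDef hρ
  set B : ℕ → Fin d → Matrix (Fin χ) (Fin χ) ℂ :=
    fun n => siteAct (U (n : ZMod L) g : Matrix (Fin d) (Fin d) ℂ) A with hBdef
  have hB : ∀ n, ∑ s, (B n s)ᴴ * B n s = 1 := fun n => sum_conjTranspose_siteAct_mul _ hA1
  set l := List.ofFn fun j : Fin L => mixedTransfer (B j) A with hl
  -- The eigenvector at bond `n` is transported by the sites `n, …, L - 1`; it starts as `x` at `L`
  -- and returns as `μ • x` at `0`.
  set X : ℕ → Fin χ × Fin χ → ℂ := fun n => (l.drop n).prod *ᵥ x with hX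
  have hX0 : X 0 = μ • x := hFx
  have hXL : X L = x := by
    simp only [hX]
    rw [List.drop_of_length_le (by simp [hl]), List.prod_nil, Matrix.one_mulVec]
  have hXs : ∀ n < L, X n = mixedTransfer (B n) A *ᵥ X (n + 1) := by
    intro n hn
    simp only [hX]
    rw [List.drop_eq_getElem_cons (by simpa [hl] using hn), List.prod_cons, Matrix.mulVec_mulVec]
    simp [hl]
  set V : ℕ → Matrix (Fin χ) (Fin χ) ℂ := fun n => unvec (X n) * ρ⁻¹ with hVdef
  have hVρ : ∀ n, V n * ρ = unvec (X n) := fun n => Matrix.nonsing_inv_mul_cancel_right _ _ hu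
  have hVs : ∀ n < L, ∑ s, B n s * (V (n + 1) * ρ) * (A s)ᴴ = V n * ρ := by
    intro n hn
    rw [hVρ, hVρ, hXs n hn, unvec_mixedTransfer_mulVec]
  have hV0 : V 0 = μ • V L := by
    simp only [hVdef, hX0, hXL, map_smul, Matrix.smul_mul]
  have hVL : V L ≠ 0 := fun h => hx (by simpa [h, hXL] using (hVρ L).symm)
  have hpos : 0 < weight ρ (V L) :=
    (weight_nonneg hρ _).lt_of_ne' fun h => hVL (eq_zero_of_weight_eq_zero hρ h)
  have hdef := fun n (hn : n < L) => weight_sub_weight_mixed hρ (hB n) hA (hVs n hn)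
  have hle : ∀ n < L, weight ρ (V n) ≤ weight ρ (V (n + 1)) := by
    intro n hn
    have : 0 ≤ weight ρ (V (n + 1)) - weight ρ (V n) := by
      rw [← hdef n hn]
      exact Finset.sum_nonneg fun s _ => weight_nonneg hρ _
    linarith
  have hw0 : weight ρ (V 0) = ‖μ‖ ^ 2 * weight ρ (V L) := by rw [hV0, weight_smul]
  have heq := eq_succ_of_le_succ_of_le hle 
    (by rw [hw0]; exact le_mul_of_one_le_left hpos.le (one_le_pow₀ hμ1))
  have heq0 : ∀ n ≤ L, weight ρ (V n) = weight ρ (V 0) := by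
    intro n
    induction n with
    | zero => exact fun _ => rfl
    | succ n ih => exact fun hn => by rw [← heq n hn, ih (by omega)]
  have hμ : ‖μ‖ = 1 := by
    have h1 : ‖μ‖ ^ 2 = 1 :=
      mul_right_cancel₀ hpos.ne' (by rw [← hw0, one_mul, heq0 L le_rfl])
    exact (pow_eq_one_iff_of_nonneg (norm_nonneg μ) two_ne_zero).1 h1
  have hVA : ∀ n < L, ∀ s, B n s * V (n + 1) = V n * A s := by
    intro n hn s
    refine eq_of_sum_weight_sub_eq_zero hρ (X := fun s => B n s * V (n + 1))
      (Y := fun s => V n * A s) ?_ s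
    rw [hdef n hn, heq n hn, sub_self]
  have hμ0 : μ ≠ 0 := norm_ne_zero_iff.1 (by rw [hμ]; exact one_ne_zero)
  obtain ⟨r, hr, hVr⟩ := exists_conjTranspose_mul_self_eq hinj hρ hA1 hA hB hVA hμ hV0
    (by rw [hV0]; exact smul_ne_zero hμ0 hVL)
  have hrc : (r : ℂ) ≠ 0 := by exact_mod_cast hr.ne'
  set W : ℕ → Matrix (Fin χ) (Fin χ) ℂ := fun n => (r : ℂ)⁻¹ • V n with hW
  have hWu : ∀ n ≤ L, (W n)ᴴ * W n = 1 := by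
    intro n hn
    simp only [hW, Matrix.conjTranspose_smul, smul_mul_smul_comm, hVr n hn, smul_smul]
    have : star (r : ℂ)⁻¹ * (r : ℂ)⁻¹ * ((r ^ 2 : ℝ) : ℂ) = 1 := by
      rw [← starRingEnd_apply, map_inv₀, Complex.conj_ofReal]
      push_cast
      field_simp
    rw [this, one_smul]
  have hWA : ∀ n < L, ∀ s, B n s = W n * A s * (W (n + 1))ᴴ := by
    intro n hn s
    have h1 : B n s * W (n + 1) = W n * A s := by
      simp only [hW, Matrix.mul_smul, Matrix.smul_mul, hVA n hn s]
    rw [← h1, Matrix.mul_assoc, mul_eq_one_comm.1 (hWu (n + 1) hn), mul_one]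
  have hW0 : W 0 = μ • W L := by
    simp only [hW, hV0]
    rw [smul_comm]
  -- Bonds `0` and `L` are identified although `W 0 = μ • W L`; the seam contributes the phase `μ`,
  -- which goes into the push-through phase.
  have hphase : ∀ j : ZMod L, ∃ κ : Circle, W (j + 1).val = (κ : ℂ) • W (j.val + 1) := by
    intro j
    rcases val_add_one_eq_or j with hj | ⟨hj, hj'⟩
    · exact ⟨1, by rw [hj]; simp⟩
    · exact ⟨⟨μ, mem_sphere_zero_iff_norm.2 hμ⟩, by rw [hj, hj', hW0]⟩
  choose κ hκ using hphase
  clear_value W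
  -- `W n` lives on the bond to the left of site `n`, whereas `v j` lives to the right of site `j`:
  -- hence the shift by one.
  refine ⟨fun j => star ⟨W (j + 1).val, Matrix.mem_unitaryGroup_iff'.2
    (hWu _ (ZMod.val_lt _).le)⟩, κ, fun j s => ?_⟩
  have h1 := hWA j.val j.val_lt s
  have h2 : B j.val = siteAct (U j g : Matrix (Fin d) (Fin d) ℂ) A := by
    simp [hBdef]
  rw [← h2, h1]
  change _ = (κ j : ℂ) • (((W (j - 1 + 1).val)ᴴ)ᴴ * A s * (W (j + 1).val)ᴴ)
  rw [sub_add_cancel, Matrix.conjTranspose_conjTranspose, hκ j, Matrix.conjTranspose_smul,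
    Matrix.mul_smul, smul_smul]
  have h3 : (κ j : ℂ) * star (κ j : ℂ) = 1 := by
    rw [← starRingEnd_apply, Complex.mul_conj, Circle.normSq_coe, Complex.ofReal_one]
  rw [h3, one_smul]

end Existence

/-! ### Unitary matrices up to phase -/

section Unitary

variable {n : Type*} [Fintype n] [DecidableEq n]

theorem unitary_coe_ne_zero [Nonempty n] (u : Matrix.unitaryGroup n ℂ) :
    (u : Matrix n n ℂ) ≠ 0 := by
  intro h
  have h1 := Matrix.UnitaryGroup.star_mul_self u
  rw [h, mul_zero] at h1
  exact zero_ne_one h1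

theorem circle_eq_of_smul_unitary_eq [Nonempty n] {a b : Circle} {u : Matrix.unitaryGroup n ℂ}
    (h : (a : ℂ) • (u : Matrix n n ℂ) = (b : ℂ) • (u : Matrix n n ℂ)) : a = b :=
  Circle.ext (smul_left_injective ℂ (unitary_coe_ne_zero u) h)

theorem exists_circle_smul_of_smul [Nonempty n] {u u' : Matrix.unitaryGroup n ℂ} {c : ℂ}
    (h : (u : Matrix n n ℂ) = c • (u' : Matrix n n ℂ)) :
    ∃ z : Circle, (u : Matrix n n ℂ) = (z : ℂ) • (u' : Matrix n n ℂ) := by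
  have h1 : star (u : Matrix n n ℂ) * (u : Matrix n n ℂ) = 1 := Matrix.UnitaryGroup.star_mul_self u
  have h2 : star (u' : Matrix n n ℂ) * (u' : Matrix n n ℂ) = 1 :=
    Matrix.UnitaryGroup.star_mul_self u'
  rw [h, star_smul, smul_mul_smul_comm, h2] at h1
  have h3 : star c * c = 1 := by
    have := congrFun (congrFun h1 (Classical.arbitrary n)) (Classical.arbitrary n)
    simpa using this
  rw [← starRingEnd_apply, mul_comm, Complex.mul_conj, Complex.normSq_eq_norm_sq] at h3
  have h4 : ‖c‖ ^ 2 = 1 := by exact_mod_cast h3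
  exact ⟨⟨c, mem_sphere_zero_iff_norm.2
    ((pow_eq_one_iff_of_nonneg (norm_nonneg c) two_ne_zero).1 h4)⟩, h⟩

theorem circle_mul_star_self (z : Circle) : (z : ℂ) * star (z : ℂ) = 1 := by
  rw [← starRingEnd_apply, Complex.mul_conj, Circle.normSq_coe, Complex.ofReal_one]

theorem exists_unitary_eq_circle_smul (z : Circle) (u : Matrix.unitaryGroup n ℂ) :
    ∃ w : Matrix.unitaryGroup n ℂ, (w : Matrix n n ℂ) = (z : ℂ) • (u : Matrix n n ℂ) := by
  refine ⟨⟨(z : ℂ) • (u : Matrix n n ℂ), Matrix.mem_unitaryGroup_iff.2 ?_⟩, rfl⟩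
  have h : (u : Matrix n n ℂ) * star (u : Matrix n n ℂ) = 1 := Matrix.mem_unitaryGroup_iff.1 u.2
  rw [star_smul, smul_mul_smul_comm, h, circle_mul_star_self, one_smul]

/-- A phase of each unitary matrix that is equivariant under multiplication by phases. -/
theorem exists_equivariant_phase [Nonempty n] :
    ∃ c : Matrix.unitaryGroup n ℂ → Circle, ∀ (u u' : Matrix.unitaryGroup n ℂ) (z : Circle),
      (u : Matrix n n ℂ) = (z : ℂ) • (u' : Matrix n n ℂ) → c u = z * c u' := by
  let r (u w : Matrix.unitaryGroup n ℂ) : Prop :=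
    ∃ z : Circle, (u : Matrix n n ℂ) = (z : ℂ) • (w : Matrix n n ℂ)
  -- The representative depends only on the predicate `r u`, hence only on the ray of `u`; `c u` is
  -- the phase of `u` relative to it.
  have hr : ∀ u, r u (Classical.epsilon (r u)) := fun u =>
    Classical.epsilon_spec (p := r u) ⟨u, 1, by simp⟩
  choose c hc using hr
  refine ⟨c, fun u u' z h => ?_⟩
  have hru : r u = r u' := by
    ext w
    constructor
    · rintro ⟨y, hy⟩
      refine ⟨z⁻¹ * y, ?_⟩
      rw [Circle.coe_mul, mul_smul, ← hy, h, smul_smul, ← Circle.coe_mul, inv_mul_cancel,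
        Circle.coe_one, one_smul]
    · rintro ⟨y, hy⟩
      exact ⟨z * y, by rw [h, hy, smul_smul, Circle.coe_mul]⟩
  have h1 := hc u
  rw [h, hc u', hru, smul_smul, ← Circle.coe_mul] at h1
  exact (circle_eq_of_smul_unitary_eq h1).symm

end Unitary

/-! ### Uniqueness of bond unitaries up to phase -/

section Uniqueness

variable {d χ : ℕ} {A : Fin d → Matrix (Fin χ) (Fin χ) ℂ} {ρ : Matrix (Fin χ) (Fin χ) ℂ}

/-- Bond unitaries that push the same operators through an injective tensor agree up to phases. -/
theorem exists_phase_of_pushThrough_eq (hinj : IsInjective A) (hρ : ρ.PosDef)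
    (hA1 : ∑ s, (A s)ᴴ * A s = 1) (hA : ∑ s, A s * ρ * (A s)ᴴ = ρ)
    {v v' : ℤ → Matrix.unitaryGroup (Fin χ) ℂ} {p p' : ℤ → Circle}
    (h : ∀ j s, (p j : ℂ) • ((v (j - 1) : Matrix (Fin χ) (Fin χ) ℂ)ᴴ * A s *
        (v j : Matrix (Fin χ) (Fin χ) ℂ)) =
      (p' j : ℂ) • ((v' (j - 1) : Matrix (Fin χ) (Fin χ) ℂ)ᴴ * A s *
        (v' j : Matrix (Fin χ) (Fin χ) ℂ))) (j : ℤ) :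
    ∃ φ : Circle, (v j : Matrix (Fin χ) (Fin χ) ℂ) = (φ : ℂ) • (v' j : Matrix (Fin χ) (Fin χ) ℂ) := by
  have hχ := (hinj.spectral hρ hA1 hA).1
  have : Nonempty (Fin χ) := ⟨⟨0, hχ⟩⟩
  set X : ℤ → Matrix (Fin χ) (Fin χ) ℂ := fun i =>
    (v i : Matrix (Fin χ) (Fin χ) ℂ) * (v' i : Matrix (Fin χ) (Fin χ) ℂ)ᴴ with hX
  have hvv : ∀ u : Matrix.unitaryGroup (Fin χ) ℂ, (u : Matrix (Fin χ) (Fin χ) ℂ) *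
      (u : Matrix (Fin χ) (Fin χ) ℂ)ᴴ = 1 := fun u => Matrix.mem_unitaryGroup_iff.1 u.2
  have hvv' : ∀ u : Matrix.unitaryGroup (Fin χ) ℂ, (u : Matrix (Fin χ) (Fin χ) ℂ)ᴴ *
      (u : Matrix (Fin χ) (Fin χ) ℂ) = 1 := fun u => Matrix.mem_unitaryGroup_iff'.1 u.2
  set q : ℤ → Circle := fun i => (p i)⁻¹ * p' i with hq
  have hAX : ∀ i s, A s * X i = (q i : ℂ) • (X (i - 1) * A s) := by
    intro i s
    have h1 := congrArg (fun M => (v (i - 1) : Matrix (Fin χ) (Fin χ) ℂ) * M *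
      (v' i : Matrix (Fin χ) (Fin χ) ℂ)ᴴ) (h i s)
    simp only [Matrix.mul_smul, Matrix.smul_mul] at h1
    have h2 : (v (i - 1) : Matrix (Fin χ) (Fin χ) ℂ) * ((v (i - 1) : Matrix (Fin χ) (Fin χ) ℂ)ᴴ *
        A s * (v i : Matrix (Fin χ) (Fin χ) ℂ)) * (v' i : Matrix (Fin χ) (Fin χ) ℂ)ᴴ =
        A s * X i := by
      simp only [hX, ← Matrix.mul_assoc, hvv, one_mul]
    have h3 : (v (i - 1) : Matrix (Fin χ) (Fin χ) ℂ) * ((v' (i - 1) : Matrix (Fin χ) (Fin χ) ℂ)ᴴ *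
        A s * (v' i : Matrix (Fin χ) (Fin χ) ℂ)) * (v' i : Matrix (Fin χ) (Fin χ) ℂ)ᴴ =
        X (i - 1) * A s := by
      simp only [hX, Matrix.mul_assoc, hvv, mul_one]
    rw [h2, h3] at h1
    rw [hq, Circle.coe_mul, mul_smul, ← h1, smul_smul, ← Circle.coe_mul, inv_mul_cancel,
      Circle.coe_one, one_smul]
  -- Walking left from bond `j`, the accumulated phases `q` are absorbed into the matrices so that
  -- the intertwining becomes exact.
  obtain ⟨c, hc⟩ := exists_eq_smul_one_of_chain hinj hρ hA1 hA
    (fun m => ((∏ i ∈ Finset.range m, q (j - i) : Circle) : ℂ) • X (j - m)) (fun m s => by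
      have hm : j - ((m + 1 : ℕ) : ℤ) = j - m - 1 := by
        push_cast
        ring
      rw [hm, Matrix.mul_smul, hAX, Matrix.smul_mul, smul_smul, ← Circle.coe_mul,
        ← Finset.prod_range_succ (fun i : ℕ => q (j - i))])
  have hXj : X j = c • 1 := by simpa using hc
  refine exists_circle_smul_of_smul (c := c) ?_
  have h1 := congrArg (· * (v' j : Matrix (Fin χ) (Fin χ) ℂ)) hXj
  simpa [hX, Matrix.mul_assoc, hvv'] using h1

theorem exists_phase_of_pushThrough_eq_zmod (hinj : IsInjective A) (hρ : ρ.PosDef)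
    (hA1 : ∑ s, (A s)ᴴ * A s = 1) (hA : ∑ s, A s * ρ * (A s)ᴴ = ρ) {L : ℕ} [NeZero L]
    {v v' : ZMod L → Matrix.unitaryGroup (Fin χ) ℂ} {p p' : ZMod L → Circle}
    (h : ∀ j s, (p j : ℂ) • ((v (j - 1) : Matrix (Fin χ) (Fin χ) ℂ)ᴴ * A s *
        (v j : Matrix (Fin χ) (Fin χ) ℂ)) =
      (p' j : ℂ) • ((v' (j - 1) : Matrix (Fin χ) (Fin χ) ℂ)ᴴ * A s *
        (v' j : Matrix (Fin χ) (Fin χ) ℂ))) (j : ZMod L) :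
    ∃ φ : Circle, (v j : Matrix (Fin χ) (Fin χ) ℂ) = (φ : ℂ) • (v' j : Matrix (Fin χ) (Fin χ) ℂ) := by
  have := exists_phase_of_pushThrough_eq hinj hρ hA1 hA (v := fun i : ℤ => v (i : ZMod L))
    (v' := fun i : ℤ => v' (i : ZMod L)) (p := fun i : ℤ => p (i : ZMod L))
    (p' := fun i : ℤ => p' (i : ZMod L)) (fun i s => by simpa using h (i : ZMod L) s) (j.val : ℤ)
  simpa using this

/-- How the push-through phase changes with the phases of the bond unitaries. -/
theorem mul_phase_eq (hχ : 0 < χ) (hA1 : ∑ s, (A s)ᴴ * A s = 1)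
    {v₀ v₁ w₀ w₁ : Matrix.unitaryGroup (Fin χ) ℂ} {p p' φ₀ φ₁ : Circle}
    (h : ∀ s, (p : ℂ) • ((v₀ : Matrix (Fin χ) (Fin χ) ℂ)ᴴ * A s *
        (v₁ : Matrix (Fin χ) (Fin χ) ℂ)) =
      (p' : ℂ) • ((w₀ : Matrix (Fin χ) (Fin χ) ℂ)ᴴ * A s * (w₁ : Matrix (Fin χ) (Fin χ) ℂ)))
    (h₀ : (v₀ : Matrix (Fin χ) (Fin χ) ℂ) = (φ₀ : ℂ) • (w₀ : Matrix (Fin χ) (Fin χ) ℂ))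
    (h₁ : (v₁ : Matrix (Fin χ) (Fin χ) ℂ) = (φ₁ : ℂ) • (w₁ : Matrix (Fin χ) (Fin χ) ℂ)) :
    p * φ₁ = p' * φ₀ := by
  have : Nonempty (Fin χ) := ⟨⟨0, hχ⟩⟩
  obtain ⟨s, hs⟩ : ∃ s, A s ≠ 0 := by
    by_contra! hz
    simp [hz] at hA1
  have hne : (w₀ : Matrix (Fin χ) (Fin χ) ℂ)ᴴ * A s * (w₁ : Matrix (Fin χ) (Fin χ) ℂ) ≠ 0 := by
    intro hz
    have h1 : (w₀ : Matrix (Fin χ) (Fin χ) ℂ) * (w₀ : Matrix (Fin χ) (Fin χ) ℂ)ᴴ = 1 :=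
      Matrix.mem_unitaryGroup_iff.1 w₀.2
    have h2 : (w₁ : Matrix (Fin χ) (Fin χ) ℂ) * (w₁ : Matrix (Fin χ) (Fin χ) ℂ)ᴴ = 1 :=
      Matrix.mem_unitaryGroup_iff.1 w₁.2
    apply hs
    calc A s = (w₀ : Matrix (Fin χ) (Fin χ) ℂ) * ((w₀ : Matrix (Fin χ) (Fin χ) ℂ)ᴴ * A s *
          (w₁ : Matrix (Fin χ) (Fin χ) ℂ)) * (w₁ : Matrix (Fin χ) (Fin χ) ℂ)ᴴ := by
            rw [← Matrix.mul_assoc, ← Matrix.mul_assoc, h1, one_mul, Matrix.mul_assoc, h2, mul_one]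
      _ = 0 := by rw [hz, mul_zero, zero_mul]
  have h2 := h s
  rw [h₀, h₁, Matrix.conjTranspose_smul, Matrix.smul_mul, Matrix.smul_mul, Matrix.mul_smul,
    smul_smul, smul_smul] at h2
  have h3 : (p : ℂ) * (star (φ₀ : ℂ) * φ₁) = p' := by
    rw [← mul_assoc]
    exact smul_left_injective ℂ hne h2
  apply Circle.ext
  rw [Circle.coe_mul, Circle.coe_mul, ← h3]
  linear_combination (-(p : ℂ) * φ₁) * circle_mul_star_self φ₀

end Uniqueness

/-! ### On-site form of the translation hypothesis -/

section Translation

theorem translation_mul_mul_apply {d n : ℕ} (O : Matrix (Fin n → Fin d) (Fin n → Fin d) ℂ)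
    (a b : Fin n → Fin d) :
    (translation d n * O * (translation d n)ᴴ) (a ∘ finRotate n) (b ∘ finRotate n) = O a b := by
  have hinj : ∀ s t : Fin n → Fin d, s ∘ finRotate n = t ∘ finRotate n ↔ s = t := fun s t =>
    (finRotate n).surjective.injective_comp_right.eq_iff
  simp [Matrix.mul_apply, translation, hinj, Matrix.conjTranspose_apply, apply_ite star]

/-- Freezing a nonzero entry at every other site leaves an equation between the two factors at site
`i`, up to constants. -/
theorem exists_smul_of_prod_eq {ι m : Type*} [Fintype ι] [DecidableEq ι] {M N : ι → Matrix m m ℂ}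
    (hN : ∀ i, N i ≠ 0) (h : ∀ s t : ι → m, ∏ i, M i (s i) (t i) = ∏ i, N i (s i) (t i)) (i : ι) :
    ∃ c : ℂ, M i = c • N i := by
  have hex : ∀ i, ∃ a b, N i a b ≠ 0 := by
    intro i
    by_contra! hz
    exact hN i (Matrix.ext hz)
  choose a b hab using hex
  have hsplit : ∀ (K : ι → Matrix m m ℂ) (x y : m),
      ∏ j, K j (Function.update a i x j) (Function.update b i y j) =
        K i x y * ∏ j ∈ Finset.univ.erase i, K j (a j) (b j) := by
    intro K x y
    rw [← Finset.mul_prod_erase _ _ (Finset.mem_univ i)]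
    congr 1
    · simp
    · refine Finset.prod_congr rfl fun j hj => ?_
      rw [Function.update_of_ne (Finset.ne_of_mem_erase hj),
        Function.update_of_ne (Finset.ne_of_mem_erase hj)]
  have hxy : ∀ x y, M i x y * ∏ j ∈ Finset.univ.erase i, M j (a j) (b j) =
      N i x y * ∏ j ∈ Finset.univ.erase i, N j (a j) (b j) := by
    intro x y
    rw [← hsplit, ← hsplit, h]
  have hNp : ∏ j ∈ Finset.univ.erase i, N j (a j) (b j) ≠ 0 :=
    Finset.prod_ne_zero_iff.2 fun j _ => hab j
  have hMp : ∏ j ∈ Finset.univ.erase i, M j (a j) (b j) ≠ 0 := by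
    intro hz
    have h1 := hxy (a i) (b i)
    rw [hz, mul_zero] at h1
    exact mul_ne_zero (hab i) hNp h1.symm
  refine ⟨(∏ j ∈ Finset.univ.erase i, N j (a j) (b j)) /
    ∏ j ∈ Finset.univ.erase i, M j (a j) (b j), Matrix.ext fun x y => ?_⟩
  rw [Matrix.smul_apply, smul_eq_mul, div_mul_eq_mul_div, eq_div_iff hMp, hxy, mul_comm]

theorem natCast_finRotate {L : ℕ} [NeZero L] (j : Fin L) :
    ((finRotate L j : ℕ) : ZMod L) = ((j : ℕ) : ZMod L) + 1 := by
  obtain ⟨n, rfl⟩ := Nat.exists_eq_succ_of_ne_zero (NeZero.ne L)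
  rw [finRotate_apply, Fin.val_add, ZMod.natCast_mod, Nat.cast_add, Fin.val_one',
    ZMod.natCast_mod, Nat.cast_one]

/-- Translation of the symmetry by one site acts by the automorphism `T` on each site,
up to phases. -/
theorem exists_site_phase {G : Type*} [Group G] {L d : ℕ} [NeZero L] [Nonempty (Fin d)]
    {T : MulAut G} {U : ZMod L → G →* Matrix.unitaryGroup (Fin d) ℂ}
    (hTU : ∀ g : G, translation d L * chainOp U L g * (translation d L)ᴴ = chainOp U L (T g))
    (j : ZMod L) (g : G) :
    ∃ z : Circle, (U (j + 1) g : Matrix (Fin d) (Fin d) ℂ) =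
      (z : ℂ) • (U j (T g) : Matrix (Fin d) (Fin d) ℂ) := by
  have key := exists_smul_of_prod_eq
    (M := fun i : Fin L => (U (((i : ℕ) : ZMod L) + 1) g : Matrix (Fin d) (Fin d) ℂ))
    (N := fun i : Fin L => (U ((i : ℕ) : ZMod L) (T g) : Matrix (Fin d) (Fin d) ℂ))
    (fun i => unitary_coe_ne_zero _) (fun s t => by
      have h1 := translation_mul_mul_apply (chainOp U L g) (s ∘ (finRotate L).symm)
        (t ∘ (finRotate L).symm)
      rw [hTU, Function.comp_assoc, Function.comp_assoc, Equiv.symm_comp_self, Function.comp_id,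
        Function.comp_id] at h1
      simp only [chainOp, Matrix.of_apply] at h1
      rw [h1, ← Equiv.prod_comp (finRotate L) fun i => (U ((i : ℕ) : ZMod L) g : Matrix _ _ ℂ)
        ((s ∘ (finRotate L).symm) i) ((t ∘ (finRotate L).symm) i)]
      simp only [Function.comp_apply, Equiv.symm_apply_apply, natCast_finRotate])
    ⟨j.val, j.val_lt⟩
  obtain ⟨c, hc⟩ := key
  simp only [ZMod.natCast_val, ZMod.cast_id', id_eq] at hc
  exact exists_circle_smul_of_smul hc

end Translation

/-! ### Gauge phases on the periodic chain -/

section Gauge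

/-- A phase on the periodic chain with trivial holonomy is a gradient. -/
theorem exists_gauge {L : ℕ} [NeZero L] (q : ZMod L → Circle) (hq : ∏ j, q j = 1) :
    ∃ θ : ZMod L → Circle, ∀ j, θ j = θ (j - 1) * q j := by
  set f : ℕ → Circle := fun n => ∏ i ∈ Finset.range n, q (i : ZMod L) with hf
  have hL : f 0 = f L := by
    obtain ⟨n, rfl⟩ := Nat.exists_eq_succ_of_ne_zero (NeZero.ne L)
    simp only [hf, Finset.range_zero, Finset.prod_empty]
    rw [← hq, Finset.prod_range]
    exact Fintype.prod_congr _ _ fun i : Fin (n + 1) => congrArg q (ZMod.natCast_zmod_val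
      (n := n + 1) i).symm
  refine ⟨fun j => f (j + 1).val, fun j => ?_⟩
  simp only [sub_add_cancel]
  rw [apply_val_add_one hL]
  simp [hf, Finset.prod_range_succ]

/-- Being a function of `z` is all that is required: equal arguments receive equal roots, so a
`T`-invariant phase has a `T`-invariant root. -/
theorem exists_circle_root (L : ℕ) [NeZero L] : ∃ r : Circle → Circle, ∀ z, r z ^ L = z := by
  refine ⟨fun z => Circle.exp (Complex.arg z / L), fun z => ?_⟩
  rw [← Circle.exp_natCast_mul, mul_div_cancel₀ _ (by exact_mod_cast NeZero.ne L), Circle.exp_arg]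

end Gauge

/-! ### Cocycles and classes in multiplicative notation -/

section Cohomology

universe u

variable {G : Type u} [Group G]

/-- A 2-cocycle from its multiplicative description. -/
def Cocycle.mk (w : G → G → Circle) (h : ∀ g₁ g₂ g₃, w (g₁ * g₂) g₃ * w g₁ g₂ =
    w g₂ g₃ * w g₁ (g₂ * g₃)) : Cocycle G :=
  ⟨fun x => Additive.ofMul (ULift.up (w x.1 x.2)),
    (groupCohomology.mem_cocycles₂_iff (A := U1 G) _).2 fun g₁ g₂ g₃ =>
      congrArg (fun z => Additive.ofMul (ULift.up z)) (h g₁ g₂ g₃)⟩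

theorem Cocycle.val_mk (w : G → G → Circle) (h) (g₁ g₂ : G) :
    (Cocycle.mk w h).val g₁ g₂ = w g₁ g₂ := rfl

theorem Cocycle.val_pullback (T : MulAut G) (ω : Cocycle G) (g₁ g₂ : G) :
    (ω.pullback T).val g₁ g₂ = ω.val (T g₁) (T g₂) := rfl

/-- Cocycles that differ by the coboundary of a phase are cohomologous. -/
theorem Cocycle.cls_eq {ω ω' : Cocycle G} (b : G → Circle)
    (h : ∀ g₁ g₂, ω.val g₁ g₂ * b (g₁ * g₂) = b g₁ * b g₂ * ω'.val g₁ g₂) : ω.cls = ω'.cls := by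
  refine (groupCohomology.H2π_eq_iff (A := U1 G) ω ω').2
    ⟨fun g => Additive.ofMul (ULift.up (b g)), funext fun ⟨g₁, g₂⟩ => ?_⟩
  have h1 : b g₂ / b (g₁ * g₂) * b g₁ = ω.val g₁ g₂ / ω'.val g₁ g₂ := by
    rw [div_mul_eq_mul_div, div_eq_div_iff_mul_eq_mul, h, mul_comm (b g₂) (b g₁)]
  exact congrArg (fun z => Additive.ofMul (ULift.up z)) h1

end Cohomology

end ModulatedMPS

end

/-! ### The main theorem -/

theorem mainTheorem2 {G : Type*} [Group G] {L d χ : ℕ} [NeZero L]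
    (T : MulAut G) (hT : T ^ L = 1)
    (U : ZMod L → G →* Matrix.unitaryGroup (Fin d) ℂ)
    (hTU : ∀ g : G,
      ModulatedMPS.translation d L * ModulatedMPS.chainOp U L g *
        (ModulatedMPS.translation d L)ᴴ = ModulatedMPS.chainOp U L (T g))
    (A : Fin d → Matrix (Fin χ) (Fin χ) ℂ)
    (hcan : ModulatedMPS.IsLeftCanonical A) (hinj : ModulatedMPS.IsInjective A)
    (hsym : ∀ (g : G) (k : ℕ), 1 ≤ k → ∃ z : Circle,
      ModulatedMPS.chainOp U (k * L) g *ᵥ ModulatedMPS.mpsState A (k * L) =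
        (z : ℂ) • ModulatedMPS.mpsState A (k * L)) :
    (∃ (v : ℤ → G → Matrix.unitaryGroup (Fin χ) ℂ) (p : ℤ → G → Circle),
      ModulatedMPS.IsPushThrough U A v p ∧ ModulatedMPS.IsCovariantPhase T U p ∧
        ∀ j : ℤ, v (j + L) = v j) ∧
    ∀ (v : ℤ → G → Matrix.unitaryGroup (Fin χ) ℂ) (p : ℤ → G → Circle),
      ModulatedMPS.IsPushThrough U A v p →
      (∃ φ : ℤ → G → Circle, ∀ (j : ℤ) (g : G),
        (v (j + 1) g : Matrix (Fin χ) (Fin χ) ℂ) =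
          (φ j g : ℂ) • (v j (T g) : Matrix (Fin χ) (Fin χ) ℂ)) ∧
      (ModulatedMPS.IsCovariantPhase T U p →
        ∃ φ : G → Circle, ∀ (j : ℤ) (g : G),
          (v (j + 1) g : Matrix (Fin χ) (Fin χ) ℂ) =
            (φ g : ℂ) • (v j (T g) : Matrix (Fin χ) (Fin χ) ℂ)) ∧
      ∃ ω : ℤ → ModulatedMPS.Cocycle G,
        (∀ (j : ℤ) (g h : G),
          (v j g : Matrix (Fin χ) (Fin χ) ℂ) * (v j h : Matrix (Fin χ) (Fin χ) ℂ) =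
            ((ω j).val g h : ℂ) • (v j (g * h) : Matrix (Fin χ) (Fin χ) ℂ)) ∧
        (∀ i j : ℤ, (ω i).cls = (ω j).cls) ∧
        ∀ j : ℤ, (ω j).cls = ((ω j).pullback T).cls := by
  open ModulatedMPS in
  obtain ⟨hA1, ρ, hρ, hA⟩ := hcan
  have hχ := (hinj.spectral hρ hA1 hA).1
  have : Nonempty (Fin χ) := ⟨⟨0, hχ⟩⟩
  have : Nonempty (Fin d) := by
    by_contra hd
    rw [not_nonempty_iff] at hd
    rw [Finset.univ_eq_empty, Finset.sum_empty] at hA1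
    exact zero_ne_one hA1
  choose lam hlam using exists_site_phase hTU
  refine ⟨?_, fun v p hv => ?_⟩
  · choose v₀ p₀ hv₀ using fun g => exists_pushThrough_cell hinj hρ hA1 hA U g (hsym g)
    obtain ⟨c, hc⟩ := exists_equivariant_phase (n := Fin d)
    obtain ⟨r, hr⟩ := exists_circle_root L
    set P : G → Circle := fun g => ∏ j, p₀ g j with hP
    set C : G → Circle := fun g => ∏ j, c (U j g) with hC
    -- Around the loop the bond phases `φ` cancel, so the total push-through phase changes only by
    -- the on-site phases `lam`.
    have hPT : ∀ g, P g = (∏ j, lam j g) * P (T g) := by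
      intro g
      have hrel : ∀ (j : ZMod L) (s : Fin d), (p₀ g (j + 1) : ℂ) •
          ((v₀ g (j - 1 + 1) : Matrix (Fin χ) (Fin χ) ℂ)ᴴ * A s *
            (v₀ g (j + 1) : Matrix (Fin χ) (Fin χ) ℂ)) = ((lam j g * p₀ (T g) j : Circle) : ℂ) •
          ((v₀ (T g) (j - 1) : Matrix (Fin χ) (Fin χ) ℂ)ᴴ * A s *
            (v₀ (T g) j : Matrix (Fin χ) (Fin χ) ℂ)) := by
        intro j s
        rw [Circle.coe_mul, mul_smul, ← hv₀, ← siteAct_smul, ← hlam, hv₀, sub_add_cancel,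
          add_sub_cancel_right]
      choose φ hφ using exists_phase_of_pushThrough_eq_zmod hinj hρ hA1 hA
        (v := fun j => v₀ g (j + 1)) (v' := v₀ (T g)) (p := fun j => p₀ g (j + 1))
        (p' := fun j => lam j g * p₀ (T g) j) hrel
      have h1 : ∀ j, p₀ g (j + 1) * φ j = lam j g * p₀ (T g) j * φ (j - 1) := fun j =>
        mul_phase_eq hχ hA1 (hrel j) (hφ (j - 1)) (hφ j)
      have h2 := Fintype.prod_congr _ _ h1
      have h3 : ∏ j, p₀ g (j + 1) = P g := Equiv.prod_comp (Equiv.addRight (1 : ZMod L)) (p₀ g)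
      have h4 : ∏ j, φ (j - 1) = ∏ j, φ j := Equiv.prod_comp (Equiv.subRight (1 : ZMod L)) φ
      rw [Finset.prod_mul_distrib, Finset.prod_mul_distrib, Finset.prod_mul_distrib, h3, h4] at h2
      exact mul_right_cancel h2
    have hCT : ∀ g, C g = (∏ j, lam j g) * C (T g) := by
      intro g
      have h1 : ∏ j, c (U (j + 1) g) = C g :=
        Equiv.prod_comp (Equiv.addRight (1 : ZMod L)) fun j => c (U j g)
      rw [← h1, ← Finset.prod_mul_distrib]
      exact Fintype.prod_congr _ _ fun j => hc _ _ _ (hlam j g)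
    have hPC : ∀ g, P g / C g = P (T g) / C (T g) := fun g => by
      rw [hPT, hCT, mul_div_mul_left_eq_div]
    -- `c (U j g)` is already covariant, and `P / C` is `T`-invariant. Spreading an `L`-th root of
    -- it evenly over the sites corrects the product to `P` and keeps covariance.
    set p₁ : ZMod L → G → Circle := fun j g => c (U j g) * r (P g / C g) with hp₁
    have hprod : ∀ g, ∏ j, p₀ g j / p₁ j g = 1 := by
      intro g
      simp only [hp₁]
      rw [Finset.prod_div_distrib, Finset.prod_mul_distrib, Finset.prod_const, Finset.card_univ,
        ZMod.card, hr, mul_div_cancel, div_self']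
    have hp₁T : ∀ j g, p₁ (j + 1) g = lam j g * p₁ j (T g) := by
      intro j g
      simp only [hp₁]
      rw [hc _ _ _ (hlam j g), hPC, mul_assoc]
    clear_value p₁
    -- `p₀` and `p₁` have the same product around the cell, so their ratio is a gradient, absorbed
    -- by rephasing the bond unitaries.
    choose θ hθ using fun g => exists_gauge _ (hprod g)
    choose w hw using fun (j : ZMod L) (g : G) => exists_unitary_eq_circle_smul (θ g j) (v₀ g j)
    refine ⟨fun j => w j, fun j => p₁ j, fun j g s => ?_, fun j g => ?_, fun j => by simp⟩
    · have h1 := hv₀ g j s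
      rw [siteAct] at h1
      change _ = (p₁ j g : ℂ) • ((w ((j - 1 : ℤ) : ZMod L) g : Matrix _ _ ℂ)ᴴ * A s *
        (w j g : Matrix _ _ ℂ))
      rw [h1, Int.cast_sub, Int.cast_one, hw, hw, Matrix.conjTranspose_smul, Matrix.smul_mul,
        Matrix.smul_mul, Matrix.mul_smul, smul_smul, smul_smul]
      congr 1
      rw [hθ g j, Circle.coe_mul, Circle.coe_div]
      have h2 : (p₁ j g : ℂ) ≠ 0 := Circle.coe_ne_zero _
      have h3 := circle_mul_star_self (θ g (j - 1))
      field_simp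
      linear_combination -h3
    · change (p₁ ((j + 1 : ℤ) : ZMod L) g : ℂ) • (U j (T g) : Matrix _ _ ℂ) =
        (p₁ j (T g) : ℂ) • (U ((j : ZMod L) + 1) g : Matrix (Fin d) (Fin d) ℂ)
      rw [Int.cast_add, Int.cast_one, hp₁T, hlam, Circle.coe_mul, smul_smul, mul_comm]
  have hv' : ∀ (j : ℤ) (g : G) (s : Fin d), siteAct (U (j : ZMod L) g : Matrix _ _ ℂ) A s =
      (p j g : ℂ) • ((v (j - 1) g : Matrix (Fin χ) (Fin χ) ℂ)ᴴ * A s *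
        (v j g : Matrix (Fin χ) (Fin χ) ℂ)) := hv
  have hrel : ∀ (g : G) (j : ℤ) (s : Fin d), (p (j + 1) g : ℂ) •
      ((v (j - 1 + 1) g : Matrix (Fin χ) (Fin χ) ℂ)ᴴ * A s *
        (v (j + 1) g : Matrix (Fin χ) (Fin χ) ℂ)) = ((lam j g * p j (T g) : Circle) : ℂ) •
      ((v (j - 1) (T g) : Matrix (Fin χ) (Fin χ) ℂ)ᴴ * A s *
        (v j (T g) : Matrix (Fin χ) (Fin χ) ℂ)) := by
    intro g j s
    have h1 := hv' (j + 1) g s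
    rw [Int.cast_add, Int.cast_one, add_sub_cancel_right] at h1
    rw [Circle.coe_mul, mul_smul, ← hv', ← siteAct_smul, ← hlam, sub_add_cancel, h1]
  choose φ hφ using fun g => exists_phase_of_pushThrough_eq hinj hρ hA1 hA
    (v := fun j => v (j + 1) g) (v' := fun j => v j (T g)) (p := fun j => p (j + 1) g)
    (p' := fun j => lam j g * p j (T g)) (hrel g)
  -- Linearity of the on-site representation lets `v_j(g) v_j(h)` push `U_{gh,j}` through as well;
  -- only phases can distinguish it from `v_j(gh)`.
  have hmul : ∀ (g h : G) (j : ℤ) (s : Fin d), ((p j g * p j h : Circle) : ℂ) •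
      (((v (j - 1) g * v (j - 1) h : Matrix.unitaryGroup (Fin χ) ℂ) :
          Matrix (Fin χ) (Fin χ) ℂ)ᴴ * A s *
        ((v j g * v j h : Matrix.unitaryGroup (Fin χ) ℂ) : Matrix (Fin χ) (Fin χ) ℂ)) =
      (p j (g * h) : ℂ) • ((v (j - 1) (g * h) : Matrix (Fin χ) (Fin χ) ℂ)ᴴ * A s *
        (v j (g * h) : Matrix (Fin χ) (Fin χ) ℂ)) := by
    intro g h j s
    have hU : (U (j : ZMod L) (g * h) : Matrix (Fin d) (Fin d) ℂ) =
        (U (j : ZMod L) g : Matrix (Fin d) (Fin d) ℂ) * U (j : ZMod L) h := by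
      rw [map_mul, Matrix.UnitaryGroup.mul_val]
    rw [← hv', hU, siteAct_mul, funext (hv' j h),
      siteAct_smul_mul_mul, hv', Matrix.UnitaryGroup.mul_val, Matrix.UnitaryGroup.mul_val,
      Matrix.conjTranspose_mul, Matrix.mul_smul, Matrix.smul_mul, smul_smul, mul_comm (p j g),
      Circle.coe_mul]
    simp only [Matrix.mul_assoc]
  choose w hw using fun (g h : G) => exists_phase_of_pushThrough_eq hinj hρ hA1 hA
    (v := fun j => v j g * v j h) (v' := fun j => v j (g * h)) (p := fun j => p j g * p j h)
    (p' := fun j => p j (g * h)) (hmul g h)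
  have hw' : ∀ (j : ℤ) (g h : G), (v j g : Matrix (Fin χ) (Fin χ) ℂ) *
      (v j h : Matrix (Fin χ) (Fin χ) ℂ) =
        (w g h j : ℂ) • (v j (g * h) : Matrix (Fin χ) (Fin χ) ℂ) := fun j g h => hw g h j
  have hcoc : ∀ (j : ℤ) (g₁ g₂ g₃ : G), w (g₁ * g₂) g₃ j * w g₁ g₂ j =
      w g₂ g₃ j * w g₁ (g₂ * g₃) j := by
    intro j g₁ g₂ g₃
    refine circle_eq_of_smul_unitary_eq (u := v j (g₁ * g₂ * g₃)) ?_
    have h1 := Matrix.mul_assoc (v j g₁).1 (v j g₂).1 (v j g₃).1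
    rw [hw', hw', Matrix.smul_mul, Matrix.mul_smul, hw', hw', smul_smul, smul_smul,
      ← mul_assoc g₁] at h1
    rw [mul_comm (w (g₁ * g₂) g₃ j), Circle.coe_mul, h1, Circle.coe_mul]
  have hstep : ∀ j : ℤ, (Cocycle.mk (fun g h => w g h j) (hcoc j)).cls =
      (Cocycle.mk (fun g h => w g h (j - 1)) (hcoc (j - 1))).cls := by
    intro j
    -- Neighbouring cocycles differ by the coboundary of the push-through phase at the site between
    -- the two bonds.
    refine Cocycle.cls_eq (fun g => (p j g)⁻¹) fun g h => ?_
    have h1 := mul_phase_eq hχ hA1 (hmul g h j) (hw g h (j - 1)) (hw g h j)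
    simp only [Cocycle.val_mk]
    rw [← mul_inv, mul_inv_eq_iff_eq_mul, mul_assoc, ← mul_comm (p j (g * h)), ← h1,
      inv_mul_cancel_left]
  have hzero : ∀ j : ℤ, (Cocycle.mk (fun g h => w g h j) (hcoc j)).cls =
      (Cocycle.mk (fun g h => w g h 0) (hcoc 0)).cls := by
    intro j
    induction j using Int.induction_on with
    | zero => rfl
    | succ i ih => rw [← ih, hstep]; simp only [add_sub_cancel_right]
    | pred i ih => rw [← ih, hstep (-(i : ℤ))]
  refine ⟨⟨fun j g => φ g j, fun j g => hφ g j⟩, fun hcov => ?_,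
    fun j => Cocycle.mk (fun g h => w g h j) (hcoc j), hw', fun i j => by rw [hzero i, hzero j],
    fun j => ?_⟩
  -- In general `φ_j / φ_{j-1}` is the failure of the phases to be covariant.
  · have hper : ∀ (g : G) (j : ℤ), φ g j = φ g (j - 1) := by
      intro g j
      have h1 := mul_phase_eq hχ hA1 (hrel g j) (hφ g (j - 1)) (hφ g j)
      have h2 := hcov j g
      rw [hlam, smul_smul] at h2
      have h3 : p (j + 1) g = p j (T g) * lam j g :=
        circle_eq_of_smul_unitary_eq (h2.trans (by rw [Circle.coe_mul]))
      rw [h3, mul_comm (lam _ g)] at h1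
      exact mul_left_cancel h1
    have hconst : ∀ (g : G) (j : ℤ), φ g j = φ g 0 := by
      intro g j
      induction j using Int.induction_on with
      | zero => rfl
      | succ i ih => rw [← ih, hper, add_sub_cancel_right]
      | pred i ih => rw [← ih, hper g (-(i : ℤ))]
    exact ⟨fun g => φ g 0, fun j g => (hφ g j).trans (by rw [hconst g j])⟩
  -- Moving to bond `j + 1` makes `v_{j+1}(g) = φ v_j(T g)` applicable: `φ` is the cochain relating
  -- `ω_{j+1}` to the pullback of `ω_j`.
  · rw [hzero j, ← hzero (j + 1)]
    refine Cocycle.cls_eq (fun g => φ g j) fun g h => ?_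
    rw [Cocycle.val_pullback, Cocycle.val_mk, Cocycle.val_mk]
    refine circle_eq_of_smul_unitary_eq (u := v j (T (g * h))) ?_
    have h1 := hw' (j + 1) g h
    have h2 : ∀ g, (v (j + 1) g : Matrix (Fin χ) (Fin χ) ℂ) =
        (φ g j : ℂ) • (v j (T g) : Matrix (Fin χ) (Fin χ) ℂ) := fun g => hφ g j
    rw [h2, h2, h2, Matrix.smul_mul, Matrix.mul_smul, hw', smul_smul, smul_smul, smul_smul,
      ← map_mul] at h1
    rw [Circle.coe_mul, ← h1, Circle.coe_mul, Circle.coe_mul, mul_assoc]
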